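/- Let $K$ be an algebraically closed field of characteristic zero, let $G$ be a finitely generated group and $H\subset G$ a finitely generated normal subgroup, let $V$ be a finite dimensional $K$-vector space and let $\rho\colon G\to \mathrm{GL}(V)$ be a representation. For a representation $\sigma\colon \Pi\to\mathrm{GL}(V)$ of a group $\Pi$ write $\mathrm{Mo}(\sigma)\subset \mathrm{GL}(V)$ for the Zariski closure of $\sigma(\Pi)$, an algebraic group over $K$, and $\mathrm{Mo}(\sigma)^0$ for its identity component. Assume that $\mathrm{Mo}(\rho|_H)$ is connected and semi-simple (that is, its radical is trivial; the trivial group is allowed). Then the following two conditions are equivalent: (1) $\rho$ is essentially admissible relative to $H$: there is a subgroup $G'\subset G$ of finite index with $H\subset G'$ such that $\rho|_{G'}$ is semi-simple, every simple constituent of $\rho|_{G'}$ has finite determinant (i.e. its determinant is a character of $G'$ with finite image), and every simple constituent of $\rho|_{G'}$ stays simple when restricted to $H$; (2) $\rho$ is algebraically isomonodromic relative to $H$: the embedding $\mathrm{Mo}(\rho|_H)^0\to\mathrm{Mo}(\rho)^0$ induced by $H\subset G$ is an isomorphism. -/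

import Mathlib

/-! ### The Zariski topology on `GL(V)` and linear algebraic groups

Throughout `K` is the (algebraically closed) ground field, and algebraic subgroups of `GL(V)` are
taken in the classical sense: Zariski closed subgroups of the group `GL(V)` of `K`-points.
-/

namespace AlgMonodromy

section Zariski

variable (K : Type*) [Field K] (V : Type*) [AddCommGroup V] [Module K V]

/-- The coordinate ring of `GL(V)`: the `K`-algebra of functions on `GL(V)` generated by the
linear functionals of `g` and of `g⁻¹` (for finite dimensional `V`: by the matrix entries of `g`
and by `(det g)⁻¹`). -/
def regularFunctions : Subalgebra K (LinearMap.GeneralLinearGroup K V → K) :=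
  Algebra.adjoin K
    ({f | ∃ φ : Module.Dual K (Module.End K V),
        f = fun g : LinearMap.GeneralLinearGroup K V => φ (g : Module.End K V)} ∪
      {f | ∃ φ : Module.Dual K (Module.End K V),
        f = fun g : LinearMap.GeneralLinearGroup K V => φ ((g⁻¹ : LinearMap.GeneralLinearGroup K V) : Module.End K V)})

/-- A subset of `GL(V)` is Zariski closed if it is the common zero set of a set of regular
functions. -/
def IsZariskiClosed (Z : Set (LinearMap.GeneralLinearGroup K V)) : Prop :=
  ∃ S : Set (LinearMap.GeneralLinearGroup K V → K),
    S ⊆ (regularFunctions K V : Set (LinearMap.GeneralLinearGroup K V → K)) ∧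
      Z = {g | ∀ f ∈ S, f g = 0}

/-- The Zariski topology on `GL(V)`: its closed sets are the Zariski closed sets. -/
@[reducible]
def zariskiTopology : TopologicalSpace (LinearMap.GeneralLinearGroup K V) :=
  TopologicalSpace.ofClosed {Z | IsZariskiClosed K V Z}
    ⟨{1}, by simp [(regularFunctions K V).one_mem], by ext; simp⟩
    (by
      intro A hA
      refine ⟨{f | f ∈ regularFunctions K V ∧ ∃ Z ∈ A, ∀ g ∈ Z, f g = 0},
        fun f hf => hf.1, ?_⟩
      ext g
      constructor
      · rintro hg f ⟨-, Z, hZ, hf⟩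
        exact hf g (hg Z hZ)
      · intro hg Z hZ
        obtain ⟨S, hS, hZS⟩ := hA hZ
        rw [hZS]
        intro f hf
        refine hg f ⟨hS hf, Z, hZ, fun x hx => ?_⟩
        rw [hZS] at hx
        exact hx f hf)
    (by
      rintro _ ⟨S, hS, rfl⟩ _ ⟨T, hT, rfl⟩
      refine ⟨{f | ∃ s ∈ S, ∃ t ∈ T, f = s * t}, ?_, ?_⟩
      · rintro _ ⟨s, hs, t, ht, rfl⟩
        exact (regularFunctions K V).mul_mem (hS hs) (hT ht)
      · ext g
        constructor
        · rintro (hg | hg) _ ⟨s, hs, t, ht, rfl⟩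
          · simp [hg s hs]
          · simp [hg t ht]
        · intro hg
          by_contra hcon
          simp only [Set.mem_union, Set.mem_ofPred_eq, not_or, not_forall] at hcon
          obtain ⟨⟨s, hs, hs0⟩, ⟨t, ht, ht0⟩⟩ := hcon
          exact (mul_ne_zero hs0 ht0) (hg _ ⟨s, hs, t, ht, rfl⟩))

attribute [local instance] zariskiTopology

variable {K V}

theorem isClosed_iff (Z : Set (LinearMap.GeneralLinearGroup K V)) :
    IsClosed Z ↔ IsZariskiClosed K V Z := by
  rw [← isOpen_compl_iff]
  change IsZariskiClosed K V Zᶜᶜ ↔ _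
  rw [compl_compl]

/-- A self-map of `GL(V)` along which regular functions pull back to regular functions is
continuous. -/
theorem continuous_of_pullback
    (e : LinearMap.GeneralLinearGroup K V → LinearMap.GeneralLinearGroup K V)
    (he : ∀ φ : Module.Dual K (Module.End K V),
      (fun g => φ (e g : Module.End K V)) ∈ regularFunctions K V ∧
      (fun g => φ (((e g)⁻¹ : LinearMap.GeneralLinearGroup K V) : Module.End K V)) ∈
        regularFunctions K V) :
    Continuous e := by
  have key : ∀ f ∈ regularFunctions K V, f ∘ e ∈ regularFunctions K V := by
    intro f hf
    induction hf using Algebra.adjoin_induction with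
    | mem f hf =>
      rcases hf with ⟨φ, rfl⟩ | ⟨φ, rfl⟩
      · exact (he φ).1
      · exact (he φ).2
    | algebraMap r => exact (regularFunctions K V).algebraMap_mem r
    | add f g _ _ hf hg => exact (regularFunctions K V).add_mem hf hg
    | mul f g _ _ hf hg => exact (regularFunctions K V).mul_mem hf hg
  rw [continuous_iff_isClosed]
  intro Z hZ
  rw [isClosed_iff] at hZ ⊢
  obtain ⟨S, hS, rfl⟩ := hZ
  refine ⟨(fun f => f ∘ e) '' S, ?_, ?_⟩
  · rintro _ ⟨f, hf, rfl⟩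
    exact key f (hS hf)
  · ext g
    simp

theorem continuous_mul_left (a : LinearMap.GeneralLinearGroup K V) :
    Continuous (fun g => a * g) := by
  refine continuous_of_pullback _ fun φ => ⟨Algebra.subset_adjoin (Or.inl ?_),
    Algebra.subset_adjoin (Or.inr ?_)⟩
  · exact ⟨φ ∘ₗ LinearMap.mulLeft K (a : Module.End K V), by ext; simp⟩
  · refine ⟨φ ∘ₗ LinearMap.mulRight K
      ((a⁻¹ : LinearMap.GeneralLinearGroup K V) : Module.End K V), ?_⟩
    ext g
    simp only [mul_inv_rev, Units.val_mul, LinearMap.comp_apply, LinearMap.mulRight_apply]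

theorem continuous_mul_right (a : LinearMap.GeneralLinearGroup K V) :
    Continuous (fun g => g * a) := by
  refine continuous_of_pullback _ fun φ => ⟨Algebra.subset_adjoin (Or.inl ?_),
    Algebra.subset_adjoin (Or.inr ?_)⟩
  · exact ⟨φ ∘ₗ LinearMap.mulRight K (a : Module.End K V), by ext; simp⟩
  · refine ⟨φ ∘ₗ LinearMap.mulLeft K
      ((a⁻¹ : LinearMap.GeneralLinearGroup K V) : Module.End K V), ?_⟩
    ext g
    simp only [mul_inv_rev, Units.val_mul, LinearMap.comp_apply, LinearMap.mulLeft_apply]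

theorem continuous_inv :
    Continuous (fun g : LinearMap.GeneralLinearGroup K V => g⁻¹) := by
  refine continuous_of_pullback _ fun φ => ⟨Algebra.subset_adjoin (Or.inr ⟨φ, rfl⟩),
    Algebra.subset_adjoin (Or.inl ⟨φ, ?_⟩)⟩
  ext g
  rw [inv_inv]

/-- The Zariski closure of a subgroup of `GL(V)`, which is an algebraic subgroup. -/
def zariskiClosure (Γ : Subgroup (LinearMap.GeneralLinearGroup K V)) :
    Subgroup (LinearMap.GeneralLinearGroup K V) where
  carrier := closure (Γ : Set (LinearMap.GeneralLinearGroup K V))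
  one_mem' := subset_closure Γ.one_mem
  inv_mem' {x} hx := map_mem_closure continuous_inv hx fun _ h => Γ.inv_mem h
  mul_mem' {x y} hx hy := by
    have h1 : ∀ a ∈ Γ, a * y ∈ closure (Γ : Set (LinearMap.GeneralLinearGroup K V)) :=
      fun a ha => map_mem_closure (continuous_mul_left a) hy fun _ h => Γ.mul_mem ha h
    have h2 := map_mem_closure (continuous_mul_right y) hx h1
    rwa [closure_closure] at h2

/-- The identity component `M⁰` of a subgroup `M` of `GL(V)`: the connected component of the
identity for the Zariski topology on `M`. -/
def identityComponent (M : Subgroup (LinearMap.GeneralLinearGroup K V)) :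
    Subgroup (LinearMap.GeneralLinearGroup K V) where
  carrier := connectedComponentIn (M : Set (LinearMap.GeneralLinearGroup K V)) 1
  one_mem' := mem_connectedComponentIn M.one_mem
  inv_mem' {x} hx := by
    refine IsPreconnected.subset_connectedComponentIn
      (isPreconnected_connectedComponentIn.image _ continuous_inv.continuousOn)
      ⟨1, mem_connectedComponentIn M.one_mem, inv_one⟩ ?_ ⟨x, hx, rfl⟩
    rintro _ ⟨y, hy, rfl⟩
    exact M.inv_mem (connectedComponentIn_subset _ _ hy)
  mul_mem' {x y} hx hy := by
    have hxM : x ∈ M := connectedComponentIn_subset _ _ hx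
    have hsub : (fun g => x * g) '' connectedComponentIn (M : Set _) 1 ⊆
        connectedComponentIn (M : Set _) x := by
      refine IsPreconnected.subset_connectedComponentIn
        (isPreconnected_connectedComponentIn.image _ (continuous_mul_left x).continuousOn)
        ⟨1, mem_connectedComponentIn M.one_mem, mul_one x⟩ ?_
      rintro _ ⟨z, hz, rfl⟩
      exact M.mul_mem hxM (connectedComponentIn_subset _ _ hz)
    rw [connectedComponentIn_eq hx]
    exact hsub ⟨y, hy, rfl⟩

/-- A subgroup of `GL(V)` is connected for the Zariski topology. -/
def IsZariskiConnected (M : Subgroup (LinearMap.GeneralLinearGroup K V)) : Prop :=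
  IsConnected (M : Set (LinearMap.GeneralLinearGroup K V))

/-- The algebraic subgroup `M` of `GL(V)` is semisimple, i.e. its radical is trivial: every
Zariski closed, connected, solvable subgroup of `M` which is normal in `M` is trivial. (The
trivial group is semisimple.) -/
def IsSemisimpleAlgGroup (M : Subgroup (LinearMap.GeneralLinearGroup K V)) : Prop :=
  ∀ N : Subgroup (LinearMap.GeneralLinearGroup K V), N ≤ M →
    (∀ m ∈ M, ∀ n ∈ N, m * n * m⁻¹ ∈ N) →
    IsZariskiClosed K V (N : Set (LinearMap.GeneralLinearGroup K V)) →
    IsZariskiConnected N → Group.IsSolvable N → N = ⊥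

end Zariski

/-! ### Representations -/

section Representations

variable {K : Type*} [Field K] {V : Type*} [AddCommGroup V] [Module K V]
  {G : Type*} [Group G]

/-- The restriction `ρ|_H` of a representation of `G` to a subgroup `H`. -/
def res (ρ : Representation K G V) (H : Subgroup G) : Representation K H V :=
  ρ.comp H.subtype

/-- `Mo(ρ)`: the Zariski closure of the image of `ρ` in `GL(V)`. -/
def Mo (ρ : Representation K G V) : Subgroup (LinearMap.GeneralLinearGroup K V) :=
  zariskiClosure (ρ.asGroupHom).range

/-- `ρ` is algebraically isomonodromic relative to `H`: the inclusion
`Mo(ρ|_H)⁰ → Mo(ρ)⁰` of algebraic subgroups of `GL(V)` is an isomorphism, i.e. the two subgroups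
are equal. -/
def IsAlgIsomonodromic (ρ : Representation K G V) (H : Subgroup G) : Prop :=
  identityComponent (Mo (res ρ H)) = identityComponent (Mo ρ)

/-- `ρ` has finite determinant: the character `det ∘ ρ` has finite image. -/
def HasFiniteDet (ρ : Representation K G V) : Prop :=
  (Set.range fun g : G => LinearMap.det (ρ g)).Finite

/-- `ρ` is admissible: it is semisimple and all its simple constituents have finite determinant.
As `ρ` is semisimple, its simple constituents are, up to isomorphism, its simple
subrepresentations. -/
def IsAdmissible (ρ : Representation K G V) : Prop :=
  ρ.IsSemisimpleRepresentation ∧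
    ∀ W : Subrepresentation ρ, W.toRepresentation.IsIrreducible →
      HasFiniteDet W.toRepresentation

/-- `ρ` is admissible relative to `H`: it is admissible and all its simple constituents stay
simple when restricted to `H`. -/
def IsAdmissibleRel (ρ : Representation K G V) (H : Subgroup G) : Prop :=
  IsAdmissible ρ ∧
    ∀ W : Subrepresentation ρ, W.toRepresentation.IsIrreducible →
      (res W.toRepresentation H).IsIrreducible

/-- `ρ` is essentially admissible relative to `H`: for some subgroup `G'` of finite index in `G`
with `H ⊆ G'` the restriction of `ρ` to `G'` is admissible relative to `H`. -/
def IsEssentiallyAdmissibleRel (ρ : Representation K G V) (H : Subgroup G) : Prop :=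
  ∃ G' : Subgroup G, G'.FiniteIndex ∧ H ≤ G' ∧ IsAdmissibleRel (res ρ G') (H.subgroupOf G')

end Representations

end AlgMonodromy

/-! Write S for `Mo (res ρ H)` and M for the identity component of `Mo ρ`. The group S is closed,
connected, semisimple, normalized by `Mo ρ`, and contained in M. Both implications are questions
about Lie algebras, because in characteristic zero a connected group is controlled by its Lie
algebra.

From (1) to (2): M has finite index in `Mo ρ` and lies in the closure of ρ(G'), so every simple
constituent W of ρ restricted to G' is M-stable. The determinant of M on W takes finitely many
values on a dense set, so it is 1 by connectedness and Lie M has trace zero on W. Let x be in Lie M.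
Since M normalizes S, bracket with x is a derivation of the semisimple algebra Lie S, hence inner,
given by some y in Lie S. Then x - y commutes with Lie S, so by Schur it is a scalar on each W,
which is simple under S. Its trace on W vanishes because Lie S is perfect, so the scalar is 0. These
W span V, so x = y, Lie M = Lie S and M = S (`lieAlg_le_of_isSemisimpleAlgGroup`,
`le_of_lieAlg_le`).

From (2) to (1): take for G' the preimage of S = M, of finite index. As ρ(G') lies in S, the closure
of ρ(H), the same subspaces are stable under H, G', S and Lie S. Weyl's theorem gives
semisimplicity, perfectness of Lie S gives determinant 1, and simplicity under H is automatic.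

Three tools carry this. The passage from Lie algebra to group rests on `ev_mul_ev_eq_of_forall_der`:
on an irreducible group, functions with equal logarithmic derivatives along the Lie algebra are
proportional. Applied to minors it shows that Lie-stable subspaces are group-stable
(`apply_mem_of_forall_lieAlg`). Semisimplicity of Lie S (`hasTrivialRadical_lieAlg`) uses formal
exponentials and the Nullstellensatz. Weyl's theorem (`exists_isCompl_lieSubmodule`) uses Casimir
elements.

Functions on GL(V) are represented by polynomials in independent variables for g and its inverse;
the relations between the two sit in the vanishing ideals. -/

namespace AlgMonodromy

/-! ### Derivations of function fields, and Jacobi's formula. -/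

section FieldDerivations

open Polynomial TrivSqZeroExt in
/-- A transcendental element of a finitely generated field extension in characteristic zero is
moved by some derivation. -/
theorem exists_derivation_ne_zero_of_transcendental {K F : Type*} [Field K] [CharZero K]
    [Field F] [Algebra K F] [Algebra.EssFiniteType K F] {q : F} (hq : Transcendental K q) :
    ∃ D : Derivation K F F, D q = 1 := by
  let a1 : Algebra K[X] F := (aeval q).toAlgebra
  have hmap : ∀ p : K[X], algebraMap K[X] F p = aeval q p := fun _ => rfl
  have : IsScalarTower K K[X] F := IsScalarTower.of_algebraMap_eq fun x => by
    rw [hmap]; simp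
  have : FaithfulSMul K[X] F := by
    rw [faithfulSMul_iff_algebraMap_injective]
    exact transcendental_iff_injective.mp hq
  let := FractionRing.liftAlgebra K[X] F
  have := FractionRing.isScalarTower_liftAlgebra K[X] F
  have : IsScalarTower K (FractionRing K[X]) F := IsScalarTower.of_algebraMap_eq fun x => by
    rw [IsScalarTower.algebraMap_apply K K[X] F, IsScalarTower.algebraMap_apply K K[X]
      (FractionRing K[X]), ← IsScalarTower.algebraMap_apply K[X] (FractionRing K[X]) F]
  have : CharZero (FractionRing K[X]) := charZero_of_injective_algebraMap
    (algebraMap K (FractionRing K[X])).injective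
  have : Algebra.EssFiniteType (FractionRing K[X]) F :=
    Algebra.EssFiniteType.of_comp K (FractionRing K[X]) F
  have : Algebra.FormallySmooth K[X] (FractionRing K[X]) :=
    Algebra.FormallySmooth.of_isLocalization (nonZeroDivisors K[X])
  have : Algebra.FormallySmooth K[X] F :=
    Algebra.FormallySmooth.comp K[X] (FractionRing K[X]) F
  -- With X sent to q + ε, the dual numbers become a K[X]-algebra over F. Formal smoothness of F
  -- over K[X] yields a section of F[ε] → F, whose ε-component is the derivation sought.
  let f0 : K[X] →ₐ[K] DualNumber F := aeval (inl q + DualNumber.eps)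
  let a2 : Algebra K[X] (DualNumber F) := f0.toAlgebra
  let g : DualNumber F →ₐ[K[X]] F :=
    { (fstHom F F F : DualNumber F →ₐ[F] F).toRingHom with
      commutes' := fun p => by
        change fstHom K F F (f0 p) = aeval q p
        have : (fstHom K F F).comp f0 = aeval q := by
          ext; simp [f0]
        rw [← this]; rfl }
  have hg : Function.Surjective g := fun x => ⟨inl x, rfl⟩
  have hker : IsNilpotent (RingHom.ker (g : DualNumber F →+* F)) := ⟨2, kerIdeal_sq F F⟩
  let s := Algebra.FormallySmooth.liftOfSurjective (AlgHom.id K[X] F) g hg hker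
  have hs : ∀ x, fst (s x) = x := fun x =>
    Algebra.FormallySmooth.liftOfSurjective_apply (AlgHom.id K[X] F) g hg hker x
  have hsq : s q = inl q + DualNumber.eps := by
    have h1 : q = algebraMap K[X] F X := by rw [hmap]; simp
    have h2 : s (algebraMap K[X] F X) = f0 X := s.commutes X
    rw [← h1] at h2
    rw [h2]; simp [f0]
  have hsK : ∀ c : K, s (algebraMap K F c) = inl (algebraMap K F c) := fun c => by
    have h2 : s (algebraMap K[X] F (C c)) = f0 (C c) := s.commutes (C c)
    rw [hmap, aeval_C] at h2
    rw [h2]; simp only [f0, aeval_C]; rfl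
  refine ⟨Derivation.mk' { toFun := fun x => snd (s x), map_add' := by simp, map_smul' := ?_ } ?_, ?_⟩
  · intro c x
    rw [Algebra.smul_def, map_mul, hsK]
    simp [Algebra.smul_def]
  · intro a b
    change snd (s (a * b)) = a * snd (s b) + b * snd (s a)
    rw [map_mul, DualNumber.snd_mul, hs, hs]
    ring
  · change snd (s q) = 1
    rw [hsq]; simp

/-- In a finitely generated domain over an algebraically closed field of characteristic zero, two
elements with the same logarithmic derivative along all derivations are proportional. -/
theorem exists_eq_smul_of_forall_derivation {K R : Type*} [Field K] [CharZero K] [IsAlgClosed K]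
    [CommRing R] [IsDomain R] [Algebra K R] [Algebra.FiniteType K R] {f h : R} (hh : h ≠ 0)
    (H : ∀ D : Derivation K R R, h * D f = f * D h) : ∃ c : K, f = c • h := by
  let F := FractionRing R
  have : Algebra.EssFiniteType K F := Algebra.EssFiniteType.comp K R F
  have hinj : Function.Injective (algebraMap R F) := IsFractionRing.injective R F
  have hh' : algebraMap R F h ≠ 0 := by simpa using hh
  let q : F := algebraMap R F f / algebraMap R F h
  have h5 : algebraMap R F f = q * algebraMap R F h := (div_mul_cancel₀ _ hh').symm
  by_cases hq : Transcendental K q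
  · exfalso
    obtain ⟨D, hD⟩ := exists_derivation_ne_zero_of_transcendental hq
    -- A common denominator d for the values of D on finitely many generators makes d·D a derivation
    -- of R itself, to which the hypothesis applies.
    obtain ⟨s, hs⟩ := (Algebra.FiniteType.out : (⊤ : Subalgebra K R).FG)
    obtain ⟨d, hd⟩ := IsLocalization.exist_integer_multiples_of_finset (nonZeroDivisors R)
      (by classical exact s.image fun x => D (algebraMap R F x))
    have key : ∀ x : R, ∃ y : R, algebraMap R F y = algebraMap R F d * D (algebraMap R F x) := by
      intro x
      have hx : x ∈ Algebra.adjoin K (s : Set R) := hs ▸ Algebra.mem_top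
      induction hx using Algebra.adjoin_induction with
      | mem x hx =>
        obtain ⟨y, hy⟩ := hd _ (by classical exact Finset.mem_image_of_mem _ hx)
        exact ⟨y, by rw [hy, Algebra.smul_def]⟩
      | algebraMap r =>
        refine ⟨0, ?_⟩
        rw [← IsScalarTower.algebraMap_apply K R F, Derivation.map_algebraMap]; simp
      | add x y _ _ hx hy =>
        obtain ⟨a, ha⟩ := hx
        obtain ⟨b, hb⟩ := hy
        exact ⟨a + b, by rw [map_add, map_add, map_add, ha, hb, mul_add]⟩
      | mul x y _ _ hx hy =>
        obtain ⟨a, ha⟩ := hx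
        obtain ⟨b, hb⟩ := hy
        refine ⟨x * b + y * a, ?_⟩
        rw [map_mul, Derivation.leibniz, map_add, map_mul, map_mul, ha, hb]
        simp only [smul_eq_mul]; ring
    choose e he using key
    let D' : Derivation K R R := Derivation.mk'
      { toFun := e
        map_add' := fun x y => hinj (by rw [map_add, he, he, he, map_add, map_add, mul_add])
        map_smul' := fun c x => hinj (by
          simp only [RingHom.id_apply]
          rw [Algebra.smul_def, Algebra.smul_def, map_mul, he, he, map_mul,
            ← IsScalarTower.algebraMap_apply K R F, Derivation.leibniz,
            Derivation.map_algebraMap]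
          simp only [smul_eq_mul, mul_zero, add_zero]; ring) }
      (fun x y => hinj (by
        simp only [LinearMap.coe_mk, AddHom.coe_mk, smul_eq_mul]
        rw [he, map_mul, Derivation.leibniz, map_add, map_mul, map_mul, he, he]
        simp only [smul_eq_mul]; ring))
    have h1 := congrArg (algebraMap R F) (H D')
    have h2 : algebraMap R F (D' f) = algebraMap R F d * D (algebraMap R F f) := he f
    have h3 : algebraMap R F (D' h) = algebraMap R F d * D (algebraMap R F h) := he h
    rw [map_mul, map_mul, h2, h3] at h1
    have hd0 : algebraMap R F (d : R) ≠ 0 := by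
      simp
    have h4 : algebraMap R F h * D (algebraMap R F f) = algebraMap R F f * D (algebraMap R F h) :=
      mul_left_cancel₀ hd0 (by linear_combination h1)
    -- Substituting f = q h and D q = 1 leaves h² = 0.
    rw [h5, Derivation.leibniz, hD] at h4
    simp only [smul_eq_mul] at h4
    exact mul_ne_zero hh' hh' (by linear_combination h4)
  · rw [Transcendental, not_not] at hq
    have hint := hq.isIntegral
    obtain ⟨c, hc⟩ := minpoly.mem_range_of_degree_eq_one K q
      (IsAlgClosed.degree_eq_one_of_irreducible K (minpoly.irreducible hint))
    refine ⟨c, hinj ?_⟩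
    rw [h5, ← hc, Algebra.smul_def, map_mul, ← IsScalarTower.algebraMap_apply K R F]

/-- Jacobi's formula: if `D A = A C` then `D (det A) = tr C · det A`, after a ring homomorphism. -/
theorem derivation_det {K R R' n : Type*} [CommRing K] [CommRing R] [CommRing R'] [Algebra K R]
    [Fintype n] [DecidableEq n] (e : R →+* R') (D : Derivation K R R) (A : Matrix n n R)
    (C : Matrix n n R') (h : A.map (fun a => e (D a)) = A.map e * C) :
    e (D A.det) = C.trace * e A.det := by
  -- The map e + ε(e ∘ D) is multiplicative by the Leibniz rule, so it commutes with det, and det(1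
  -- + εC) = 1 + ε tr C.
  let φ : R →+* DualNumber R' :=
    { toFun := fun a => TrivSqZeroExt.inl (e a) + TrivSqZeroExt.inr (e (D a))
      map_one' := by simp
      map_zero' := by simp
      map_add' := fun a b => by ext <;> simp
      map_mul' := fun a b => by
        ext
        · simp
        · simp [mul_comm] }
  have h1 : A.map φ = (A.map e).map (algebraMap R' (DualNumber R')) *
      (1 + (DualNumber.eps : DualNumber R') • C.map (algebraMap R' (DualNumber R'))) := by
    rw [mul_add, mul_one, Matrix.mul_smul, ← Matrix.map_mul, ← h]
    ext i j <;> simp [φ, TrivSqZeroExt.algebraMap_eq_inl]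
  have h2 := congrArg Matrix.det h1
  rw [Matrix.det_mul, Matrix.det_one_add_smul, ← RingHom.mapMatrix_apply, ← RingHom.map_det,
    ← RingHom.mapMatrix_apply, ← RingHom.map_det, DualNumber.eps_pow_two, mul_zero, add_zero,
    ← RingHom.mapMatrix_apply, ← RingHom.map_det] at h2
  have h3 := congrArg TrivSqZeroExt.snd h2
  have h4 : Matrix.trace (C.map (algebraMap R' (DualNumber R'))) =
      algebraMap R' (DualNumber R') C.trace := by
    simp [Matrix.trace]
  rw [h4] at h3
  simpa [φ, TrivSqZeroExt.algebraMap_eq_inl, mul_comm] using h3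

end FieldDerivations

/-! ### Polynomial coordinates on GL(V), invariant vector fields, translations. -/

section Coordinates

open MvPolynomial Module

variable (K : Type*) [Field K] (V : Type*) [AddCommGroup V] [Module K V] [FiniteDimensional K V]

/-- Polynomials in the coordinates of `g` and of `g⁻¹`, where `g` is in `GL(V)`. -/
abbrev CoordPoly : Type _ :=
  MvPolynomial (Fin (finrank K (End K V)) ⊕ Fin (finrank K (End K V))) K

/-- The basis of `End V` used to define coordinates. -/
noncomputable abbrev endBasis : Basis (Fin (finrank K (End K V))) K (End K V) :=
  finBasis K (End K V)

variable {K V}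

/-- The linear function `g ↦ φ g` as a polynomial. -/
noncomputable def lin : Dual K (End K V) →ₗ[K] CoordPoly K V where
  toFun φ := ∑ i, φ (endBasis K V i) • X (Sum.inl i)
  map_add' φ ψ := by simp [add_smul, Finset.sum_add_distrib]
  map_smul' c φ := by simp [Finset.smul_sum, mul_smul]

/-- The function `g ↦ φ g⁻¹` as a polynomial. -/
noncomputable def linInv : Dual K (End K V) →ₗ[K] CoordPoly K V where
  toFun φ := ∑ i, φ (endBasis K V i) • X (Sum.inr i)
  map_add' φ ψ := by simp [add_smul, Finset.sum_add_distrib]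
  map_smul' c φ := by simp [Finset.smul_sum, mul_smul]

theorem lin_coord (i : Fin (finrank K (End K V))) :
    lin ((endBasis K V).coord i) = X (Sum.inl i) := by
  simp [lin, Finsupp.single_apply, ite_smul]

theorem linInv_coord (i : Fin (finrank K (End K V))) :
    linInv ((endBasis K V).coord i) = X (Sum.inr i) := by
  simp [linInv, Finsupp.single_apply, ite_smul]

/-- Two linear maps on `Dual (End V)` agree if they agree on coordinates. -/
theorem dual_linearMap_ext {M : Type*} [AddCommGroup M] [Module K M]
    {F G : Dual K (End K V) →ₗ[K] M}
    (h : ∀ i, F ((endBasis K V).coord i) = G ((endBasis K V).coord i)) (φ : Dual K (End K V)) :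
    F φ = G φ := by
  have : F = G := (endBasis K V).dualBasis.ext fun i => by
    rw [Basis.coe_dualBasis]; exact h i
  rw [this]

/-- The algebra homomorphism with prescribed values on `lin` and `linInv`. -/
noncomputable def coordLift {A : Type*} [CommRing A] [Algebra K A]
    (F G : Dual K (End K V) →ₗ[K] A) : CoordPoly K V →ₐ[K] A :=
  aeval (Sum.elim (fun i => F ((endBasis K V).coord i)) (fun i => G ((endBasis K V).coord i)))

@[simp]
theorem coordLift_lin {A : Type*} [CommRing A] [Algebra K A]
    (F G : Dual K (End K V) →ₗ[K] A) (φ : Dual K (End K V)) : coordLift F G (lin φ) = F φ :=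
  dual_linearMap_ext (F := (coordLift F G).toLinearMap ∘ₗ lin) (G := F)
    (fun i => by simp [lin_coord, coordLift]) φ

@[simp]
theorem coordLift_linInv {A : Type*} [CommRing A] [Algebra K A]
    (F G : Dual K (End K V) →ₗ[K] A) (φ : Dual K (End K V)) : coordLift F G (linInv φ) = G φ :=
  dual_linearMap_ext (F := (coordLift F G).toLinearMap ∘ₗ linInv) (G := G)
    (fun i => by simp [linInv_coord, coordLift]) φ

theorem coordPoly_algHom_ext {A : Type*} [CommRing A] [Algebra K A] {F G : CoordPoly K V →ₐ[K] A}
    (h : ∀ φ, F (lin φ) = G (lin φ)) (h' : ∀ φ, F (linInv φ) = G (linInv φ)) : F = G := by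
  ext (i | i)
  · rw [← lin_coord]; exact h _
  · rw [← linInv_coord]; exact h' _

theorem coordPoly_derivation_ext {M : Type*} [AddCommGroup M] [Module K M]
    [Module (CoordPoly K V) M] [IsScalarTower K (CoordPoly K V) M]
    {D D' : Derivation K (CoordPoly K V) M}
    (h : ∀ φ, D (lin φ) = D' (lin φ)) (h' : ∀ φ, D (linInv φ) = D' (linInv φ)) : D = D' := by
  refine MvPolynomial.derivation_ext ?_
  rintro (i | i)
  · rw [← lin_coord]; exact h _
  · rw [← linInv_coord]; exact h' _

theorem coordPoly_induction {p : CoordPoly K V → Prop} (f : CoordPoly K V)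
    (hC : ∀ c, p (C c)) (hadd : ∀ f g, p f → p g → p (f + g)) (hmul : ∀ f g, p f → p g → p (f * g))
    (hlin : ∀ φ, p (lin φ)) (hlinInv : ∀ φ, p (linInv φ)) : p f := by
  induction f using MvPolynomial.induction_on with
  | C a => exact hC a
  | add f g hf hg => exact hadd f g hf hg
  | mul_X f i hf =>
    refine hmul f _ hf ?_
    rcases i with i | i
    · rw [← lin_coord]; exact hlin _
    · rw [← linInv_coord]; exact hlinInv _

/-- Evaluation of polynomials at a point of `GL(V)`. -/
noncomputable def ev (g : LinearMap.GeneralLinearGroup K V) : CoordPoly K V →ₐ[K] K :=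
  coordLift (LinearMap.applyₗ (g : End K V))
    (LinearMap.applyₗ ((g⁻¹ : LinearMap.GeneralLinearGroup K V) : End K V))

@[simp]
theorem ev_lin (g : LinearMap.GeneralLinearGroup K V) (φ : Dual K (End K V)) :
    ev g (lin φ) = φ (g : End K V) := by simp [ev]

@[simp]
theorem ev_linInv (g : LinearMap.GeneralLinearGroup K V) (φ : Dual K (End K V)) :
    ev g (linInv φ) = φ ((g⁻¹ : LinearMap.GeneralLinearGroup K V) : End K V) := by
  simp only [ev, coordLift_linInv]; rfl

/-- The derivation `D_x` of the polynomials given by the left invariant vector field of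
`x ∈ End V`: `D_x f (g) = d/dt f(g (1 + t x))` at `t = 0`. -/
noncomputable def der (x : End K V) : Derivation K (CoordPoly K V) (CoordPoly K V) :=
  mkDerivation K (Sum.elim
    (fun i => lin ((endBasis K V).coord i ∘ₗ LinearMap.mulRight K x))
    -- To first order, the inverse of g(1 + tx) is (1 - tx)g⁻¹.
    (fun i => -linInv ((endBasis K V).coord i ∘ₗ LinearMap.mulLeft K x)))

@[simp]
theorem der_lin (x : End K V) (φ : Dual K (End K V)) :
    der x (lin φ) = lin (φ ∘ₗ LinearMap.mulRight K x) :=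
  dual_linearMap_ext (F := (der x).toLinearMap ∘ₗ lin)
    (G := lin ∘ₗ LinearMap.lcomp K K (LinearMap.mulRight K x))
    (fun i => by simp [lin_coord, der, mkDerivation_X, LinearMap.lcomp_apply']) φ

@[simp]
theorem der_linInv (x : End K V) (φ : Dual K (End K V)) :
    der x (linInv φ) = -linInv (φ ∘ₗ LinearMap.mulLeft K x) :=
  dual_linearMap_ext (F := (der x).toLinearMap ∘ₗ linInv)
    (G := -(linInv ∘ₗ LinearMap.lcomp K K (LinearMap.mulLeft K x)))
    (fun i => by simp [linInv_coord, der, mkDerivation_X, LinearMap.lcomp_apply']) φ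

theorem der_add (x y : End K V) : der (x + y) = der x + der y := by
  refine coordPoly_derivation_ext (fun φ => ?_) fun φ => ?_
  · simp only [der_lin, Derivation.add_apply, ← map_add]
    congr 1; ext; simp [mul_add]
  · simp only [der_linInv, Derivation.add_apply, ← neg_add, ← map_add]
    congr 2; ext; simp [add_mul]

theorem der_smul (c : K) (x : End K V) : der (c • x) = c • der x := by
  refine coordPoly_derivation_ext (fun φ => ?_) fun φ => ?_
  · simp only [der_lin, Derivation.smul_apply, ← map_smul]
    congr 1; ext; simp
  · simp only [der_linInv, Derivation.smul_apply, smul_neg, ← map_smul]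
    congr 2; ext; simp

theorem der_zero : der (0 : End K V) = 0 := by
  have := der_smul (0 : K) (0 : End K V)
  simpa using this

/-- No sign appears because left invariant fields act on coordinates through right multiplication.
This closes `lieAlg` under brackets. -/
theorem der_commutator (x y : End K V) : der (x * y - y * x) = ⁅der x, der y⁆ := by
  refine coordPoly_derivation_ext (fun φ => ?_) fun φ => ?_
  · simp only [der_lin, Derivation.commutator_apply, ← map_sub]
    congr 1; ext; simp [mul_sub, mul_assoc]
  · simp only [der_linInv, Derivation.commutator_apply, map_neg, neg_neg, ← map_sub]
    rw [← map_neg]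
    congr 1; ext; simp [sub_mul, mul_assoc]

/-- Left translation of polynomials: `f ↦ (a ↦ f (g a))`. -/
noncomputable def leftTrans (g : LinearMap.GeneralLinearGroup K V) :
    CoordPoly K V →ₐ[K] CoordPoly K V :=
  coordLift (lin ∘ₗ LinearMap.lcomp K K (LinearMap.mulLeft K (g : End K V)))
    (linInv ∘ₗ LinearMap.lcomp K K
      (LinearMap.mulRight K ((g⁻¹ : LinearMap.GeneralLinearGroup K V) : End K V)))

theorem leftTrans_lin (g : LinearMap.GeneralLinearGroup K V) (φ : Dual K (End K V)) :
    leftTrans g (lin φ) = lin (φ ∘ₗ LinearMap.mulLeft K (g : End K V)) := by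
  simp only [leftTrans, coordLift_lin]; rfl

theorem leftTrans_linInv (g : LinearMap.GeneralLinearGroup K V) (φ : Dual K (End K V)) :
    leftTrans g (linInv φ) = linInv (φ ∘ₗ
      LinearMap.mulRight K ((g⁻¹ : LinearMap.GeneralLinearGroup K V) : End K V)) := by
  simp only [leftTrans, coordLift_linInv]; rfl

theorem ev_leftTrans (a g : LinearMap.GeneralLinearGroup K V) (f : CoordPoly K V) :
    ev a (leftTrans g f) = ev (g * a) f := by
  have : (ev a).comp (leftTrans g) = ev (g * a) := by
    refine coordPoly_algHom_ext (fun φ => ?_) fun φ => ?_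
    · simp [leftTrans_lin]
    · simp only [AlgHom.comp_apply, leftTrans_linInv, ev_linInv, mul_inv_rev, Units.val_mul]; rfl
  rw [← this]; rfl

/-- Left and right multiplication commute. This left invariance lets conditions at the identity be
moved to every point of a subgroup. -/
theorem der_leftTrans (x : End K V) (g : LinearMap.GeneralLinearGroup K V) (f : CoordPoly K V) :
    der x (leftTrans g f) = leftTrans g (der x f) := by
  induction f using coordPoly_induction with
  | hC c => simp [← MvPolynomial.algebraMap_eq]
  | hadd f g hf hg => simp [hf, hg]
  | hmul f g hf hg => simp [hf, hg]
  | hlin φ =>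
    simp only [leftTrans_lin, der_lin]
    congr 1
  | hlinInv φ =>
    simp only [leftTrans_linInv, der_linInv, map_neg]
    congr 2

/-- Right translation of polynomials: `f ↦ (a ↦ f (a g))`. -/
noncomputable def rightTrans (g : LinearMap.GeneralLinearGroup K V) :
    CoordPoly K V →ₐ[K] CoordPoly K V :=
  coordLift (lin ∘ₗ LinearMap.lcomp K K (LinearMap.mulRight K (g : End K V)))
    (linInv ∘ₗ LinearMap.lcomp K K
      (LinearMap.mulLeft K ((g⁻¹ : LinearMap.GeneralLinearGroup K V) : End K V)))

theorem rightTrans_lin (g : LinearMap.GeneralLinearGroup K V) (φ : Dual K (End K V)) :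
    rightTrans g (lin φ) = lin (φ ∘ₗ LinearMap.mulRight K (g : End K V)) := by
  simp only [rightTrans, coordLift_lin]; rfl

theorem rightTrans_linInv (g : LinearMap.GeneralLinearGroup K V) (φ : Dual K (End K V)) :
    rightTrans g (linInv φ) = linInv (φ ∘ₗ
      LinearMap.mulLeft K ((g⁻¹ : LinearMap.GeneralLinearGroup K V) : End K V)) := by
  simp only [rightTrans, coordLift_linInv]; rfl

theorem ev_rightTrans (a g : LinearMap.GeneralLinearGroup K V) (f : CoordPoly K V) :
    ev a (rightTrans g f) = ev (a * g) f := by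
  have : (ev a).comp (rightTrans g) = ev (a * g) := by
    refine coordPoly_algHom_ext (fun φ => ?_) fun φ => ?_
    · simp [rightTrans_lin]
    · simp only [AlgHom.comp_apply, rightTrans_linInv, ev_linInv, mul_inv_rev, Units.val_mul]; rfl
  rw [← this]; rfl

/-- Regular functions on `GL(V)` are given by polynomials. -/
theorem mem_regularFunctions_iff (f : LinearMap.GeneralLinearGroup K V → K) :
    f ∈ regularFunctions K V ↔ ∃ p : CoordPoly K V, ∀ g, ev g p = f g := by
  constructor
  · intro hf
    induction hf using Algebra.adjoin_induction with
    | mem f hf =>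
      rcases hf with ⟨φ, rfl⟩ | ⟨φ, rfl⟩
      · exact ⟨lin φ, fun g => by simp⟩
      · exact ⟨linInv φ, fun g => ev_linInv g φ⟩
    | algebraMap r => exact ⟨C r, fun g => by simp [← MvPolynomial.algebraMap_eq]⟩
    | add f g _ _ hf hg =>
      obtain ⟨p, hp⟩ := hf
      obtain ⟨q, hq⟩ := hg
      exact ⟨p + q, fun a => by simp [hp, hq]⟩
    | mul f g _ _ hf hg =>
      obtain ⟨p, hp⟩ := hf
      obtain ⟨q, hq⟩ := hg
      exact ⟨p * q, fun a => by simp [hp, hq]⟩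
  · rintro ⟨p, hp⟩
    obtain rfl : (fun g => ev g p) = f := funext hp
    clear hp
    induction p using coordPoly_induction with
    | hC c =>
      simp only [← MvPolynomial.algebraMap_eq, AlgHom.commutes]
      exact (regularFunctions K V).algebraMap_mem c
    | hadd f g hf hg =>
      simp only [map_add]; exact (regularFunctions K V).add_mem hf hg
    | hmul f g hf hg =>
      simp only [map_mul]; exact (regularFunctions K V).mul_mem hf hg
    | hlin φ => exact Algebra.subset_adjoin (Or.inl ⟨φ, by ext; simp⟩)
    | hlinInv φ => exact Algebra.subset_adjoin (Or.inr ⟨φ, by ext g; exact ev_linInv g φ⟩)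

/-- The ideal of polynomials vanishing on a subset of `GL(V)`. -/
noncomputable def vanishing (S : Set (LinearMap.GeneralLinearGroup K V)) :
    Ideal (CoordPoly K V) :=
  ⨅ g ∈ S, RingHom.ker (ev g)

theorem mem_vanishing {S : Set (LinearMap.GeneralLinearGroup K V)} {f : CoordPoly K V} :
    f ∈ vanishing S ↔ ∀ g ∈ S, ev g f = 0 := by
  simp [vanishing, RingHom.mem_ker]

attribute [local instance] zariskiTopology

theorem isClosed_setOf_ev_eq_zero (T : Set (CoordPoly K V)) :
    IsClosed {g : LinearMap.GeneralLinearGroup K V | ∀ f ∈ T, ev g f = 0} := by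
  rw [isClosed_iff]
  refine ⟨(fun p g => ev g p) '' T, ?_, ?_⟩
  · rintro _ ⟨p, -, rfl⟩
    exact (mem_regularFunctions_iff _).2 ⟨p, fun _ => rfl⟩
  · ext g; simp

theorem isClosed_setOf_ev_eq_zero' (f : CoordPoly K V) :
    IsClosed {g : LinearMap.GeneralLinearGroup K V | ev g f = 0} := by
  simpa using isClosed_setOf_ev_eq_zero ({f} : Set (CoordPoly K V))

theorem mem_of_isClosed {S : Set (LinearMap.GeneralLinearGroup K V)} (hS : IsClosed S)
    {g : LinearMap.GeneralLinearGroup K V} (hg : ∀ f ∈ vanishing S, ev g f = 0) : g ∈ S := by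
  rw [isClosed_iff] at hS
  obtain ⟨T, hT, rfl⟩ := hS
  intro f hf
  obtain ⟨p, hp⟩ := (mem_regularFunctions_iff f).1 (hT hf)
  rw [← hp]
  exact hg p (mem_vanishing.2 fun a ha => by rw [hp]; exact ha f hf)

theorem isClosed_iff_exists_coordPoly {S : Set (LinearMap.GeneralLinearGroup K V)} :
    IsClosed S ↔ ∃ T : Set (CoordPoly K V), S = {g | ∀ f ∈ T, ev g f = 0} := by
  refine ⟨fun h => ⟨vanishing S, ?_⟩, ?_⟩
  · ext g
    exact ⟨fun hg f hf => mem_vanishing.1 hf g hg, fun hg => mem_of_isClosed h hg⟩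
  · rintro ⟨T, rfl⟩
    exact isClosed_setOf_ev_eq_zero T

end Coordinates

/-! ### The Lie algebra of a subgroup, and logarithmic derivatives. -/

section LieAlgebra

open MvPolynomial Module

attribute [local instance] zariskiTopology LieRing.ofAssociativeRing

variable {K : Type*} [Field K] {V : Type*} [AddCommGroup V] [Module K V] [FiniteDimensional K V]

/-- The function `g ↦ φ (g a g⁻¹)` as a polynomial. -/
noncomputable def conjPoly (a : End K V) (φ : Dual K (End K V)) : CoordPoly K V :=
  ∑ i, lin (φ ∘ₗ LinearMap.mulRight K (a * endBasis K V i)) * linInv ((endBasis K V).coord i)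

/-- Expanding c in the basis separates variables: it lets g a g⁻¹ be written bilinearly in the
coordinates of g and of g⁻¹. -/
theorem sum_apply_coord (φ : Dual K (End K V)) (a b c : End K V) :
    ∑ i, φ (a * (b * endBasis K V i)) * (endBasis K V).coord i c = φ (a * b * c) := by
  conv_rhs => rw [← (endBasis K V).sum_repr c]
  rw [Finset.mul_sum, map_sum]
  simp [mul_comm, mul_assoc]

theorem ev_conjPoly (g : LinearMap.GeneralLinearGroup K V) (a : End K V) (φ : Dual K (End K V)) :
    ev g (conjPoly a φ) =
      φ (g * a * ((g⁻¹ : LinearMap.GeneralLinearGroup K V) : End K V)) := by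
  rw [← sum_apply_coord]
  simp [conjPoly, -Basis.coord_apply, mul_assoc]

theorem ev_der_conjPoly (g : LinearMap.GeneralLinearGroup K V) (x a : End K V)
    (φ : Dual K (End K V)) : ev g (der x (conjPoly a φ)) =
      φ (g * (x * a - a * x) * ((g⁻¹ : LinearMap.GeneralLinearGroup K V) : End K V)) := by
  have h1 := sum_apply_coord φ g (x * a) ((g⁻¹ : LinearMap.GeneralLinearGroup K V) : End K V)
  have h2 := sum_apply_coord φ g a (x * ((g⁻¹ : LinearMap.GeneralLinearGroup K V) : End K V))
  simp only [conjPoly, map_sum, Derivation.leibniz, smul_eq_mul, map_add, map_mul, der_lin,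
    der_linInv, map_neg, ev_lin, ev_linInv, Finset.sum_add_distrib, LinearMap.comp_apply,
    LinearMap.mulRight_apply, LinearMap.mulLeft_apply, mul_neg, Finset.sum_neg_distrib]
  rw [mul_sub, sub_mul, map_sub, sub_eq_neg_add, ← h1]
  rw [show (g : End K V) * (a * x) * ((g⁻¹ : LinearMap.GeneralLinearGroup K V) : End K V) =
    g * a * (x * ((g⁻¹ : LinearMap.GeneralLinearGroup K V) : End K V)) by simp only [mul_assoc],
    ← h2]
  congr 1
  refine Finset.sum_congr rfl fun i _ => ?_
  rw [mul_comm, mul_assoc, mul_assoc]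

theorem leftTrans_mem_vanishing {S : Subgroup (LinearMap.GeneralLinearGroup K V)}
    {g : LinearMap.GeneralLinearGroup K V} (hg : g ∈ S) {f : CoordPoly K V}
    (hf : f ∈ vanishing (S : Set (LinearMap.GeneralLinearGroup K V))) :
    leftTrans g f ∈ vanishing (S : Set (LinearMap.GeneralLinearGroup K V)) := by
  rw [mem_vanishing] at hf ⊢
  intro a ha
  rw [ev_leftTrans]
  exact hf _ (S.mul_mem hg ha)

/-- The Lie algebra of a subgroup of `GL(V)`. -/
noncomputable def lieAlg (S : Subgroup (LinearMap.GeneralLinearGroup K V)) :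
    LieSubalgebra K (End K V) where
  carrier := {x | ∀ f ∈ vanishing (S : Set (LinearMap.GeneralLinearGroup K V)),
    der x f ∈ vanishing (S : Set (LinearMap.GeneralLinearGroup K V))}
  add_mem' {x y} hx hy f hf := by
    rw [der_add, Derivation.add_apply]; exact add_mem (hx f hf) (hy f hf)
  zero_mem' f hf := by rw [der_zero]; exact zero_mem _
  smul_mem' c x hx f hf := by
    rw [der_smul, Derivation.smul_apply, MvPolynomial.smul_eq_C_mul]
    exact Ideal.mul_mem_left _ _ (hx f hf)
  lie_mem' {x y} hx hy f hf := by
    change der (x * y - y * x) f ∈ _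
    rw [der_commutator, Derivation.commutator_apply]
    exact sub_mem (hx _ (hy f hf)) (hy _ (hx f hf))

theorem mem_lieAlg {S : Subgroup (LinearMap.GeneralLinearGroup K V)} {x : End K V} :
    x ∈ lieAlg S ↔ ∀ f ∈ vanishing (S : Set (LinearMap.GeneralLinearGroup K V)),
      der x f ∈ vanishing (S : Set (LinearMap.GeneralLinearGroup K V)) := Iff.rfl

/-- Tangency at 1 suffices, since left translation by elements of S preserves the vanishing ideal
and commutes with `der x`. -/
theorem mem_lieAlg_iff {S : Subgroup (LinearMap.GeneralLinearGroup K V)} {x : End K V} :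
    x ∈ lieAlg S ↔ ∀ f ∈ vanishing (S : Set (LinearMap.GeneralLinearGroup K V)),
      ev 1 (der x f) = 0 := by
  rw [mem_lieAlg]
  constructor
  · intro h f hf
    exact mem_vanishing.1 (h f hf) 1 S.one_mem
  · intro h f hf
    rw [mem_vanishing]
    intro g hg
    have := h _ (leftTrans_mem_vanishing hg hf)
    rwa [der_leftTrans, ev_leftTrans, mul_one] at this

theorem lieAlg_mono {S T : Subgroup (LinearMap.GeneralLinearGroup K V)} (h : S ≤ T) :
    lieAlg S ≤ lieAlg T := by
  intro x hx
  rw [mem_lieAlg_iff] at hx ⊢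
  exact fun f hf => hx f (mem_vanishing.2 fun g hg => mem_vanishing.1 hf g (h hg))

/-- The derivations of the coordinate ring of `S` are pointwise given by left invariant vector
fields. -/
theorem exists_lieAlg_ev_eq {S : Subgroup (LinearMap.GeneralLinearGroup K V)}
    (d : CoordPoly K V → K) {g : LinearMap.GeneralLinearGroup K V} (hg : g ∈ S)
    (hadd : ∀ p q, d (p + q) = d p + d q) (hC : ∀ c, d (C c) = 0)
    (hmul : ∀ p q, d (p * q) = ev g p * d q + ev g q * d p)
    (hd : ∀ f ∈ vanishing (S : Set (LinearMap.GeneralLinearGroup K V)), d f = 0) :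
    ∃ x ∈ lieAlg S, ∀ p, d p = ev g (der x p) := by
  let dl : CoordPoly K V →ₗ[K] K :=
    { toFun := d
      map_add' := hadd
      map_smul' := fun c p => by
        rw [MvPolynomial.smul_eq_C_mul, hmul, hC]; simp [← MvPolynomial.algebraMap_eq] }
  have hdl : ∀ p, dl p = d p := fun _ => rfl
  let y : End K V := ∑ i, d (lin ((endBasis K V).coord i)) • endBasis K V i
  let y' : End K V := ∑ i, d (linInv ((endBasis K V).coord i)) • endBasis K V i
  have hy : ∀ φ, φ y = d (lin φ) := by
    intro φ
    refine dual_linearMap_ext (F := LinearMap.applyₗ y) (G := dl ∘ₗ lin) (fun i => ?_) φ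
    simp [y, hdl, Finsupp.single_apply]
  have hy' : ∀ φ, φ y' = d (linInv φ) := by
    intro φ
    refine dual_linearMap_ext (F := LinearMap.applyₗ y') (G := dl ∘ₗ linInv) (fun i => ?_) φ
    simp [y', hdl, Finsupp.single_apply]
  let g' : End K V := ((g⁻¹ : LinearMap.GeneralLinearGroup K V) : End K V)
  have hgg' : (g : End K V) * g' = 1 := Units.mul_inv g
  have hg'g : g' * (g : End K V) = 1 := Units.inv_mul g
  have hrel : ∀ φ : Dual K (End K V), φ (y * g') + φ (g * y') = 0 := by
    intro φ
    -- The polynomial expressing g g⁻¹ = 1 vanishes on all of GL(V). Applying d to it ties y' to y,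
    -- so that d is determined by y alone.
    have h1 : d (conjPoly 1 φ - C (φ 1)) = 0 := hd _ (mem_vanishing.2 fun a _ => by
      rw [map_sub, ev_conjPoly]
      simp [← MvPolynomial.algebraMap_eq])
    rw [← hdl, map_sub, hdl, hdl, hC, sub_zero, conjPoly, ← hdl, map_sum] at h1
    simp only [hdl, hmul, ← hy, ← hy', ev_lin, ev_linInv, Finset.sum_add_distrib] at h1
    have h2 := sum_apply_coord φ g 1 y'
    have h3 := sum_apply_coord φ y 1 g'
    simp only [mul_one] at h2 h3
    rw [← h2, ← h3, ← h1, add_comm]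
    congr 1
    exact Finset.sum_congr rfl fun i _ => mul_comm _ _
  have hyy : g * y' = -(y * g') := by
    refine (Module.forall_dual_apply_eq_zero_iff K _).1 (fun φ => ?_) |> eq_neg_of_add_eq_zero_left
    rw [map_add, add_comm]; exact hrel φ
  have key : ∀ p, d p = ev g (der (g' * y) p) := by
    intro p
    induction p using coordPoly_induction with
    | hC c => rw [hC, ← MvPolynomial.algebraMap_eq]; simp
    | hadd p q hp hq => rw [hadd, hp, hq, map_add, map_add]
    | hmul p q hp hq => rw [hmul, hp, hq]; simp
    | hlin φ =>
      rw [← hy, der_lin, ev_lin]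
      simp only [LinearMap.comp_apply, LinearMap.mulRight_apply]
      rw [← mul_assoc, hgg', one_mul]
    | hlinInv φ =>
      rw [← hy', der_linInv, map_neg, ev_linInv]
      simp only [LinearMap.comp_apply, LinearMap.mulLeft_apply]
      rw [← map_neg, mul_assoc, ← mul_neg, ← hyy, ← mul_assoc, hg'g, one_mul]
  -- The tangent vector y at g is moved to the identity as g⁻¹y; applying d to the translate of f by
  -- g⁻¹ shows tangency to S there.
  refine ⟨g' * y, mem_lieAlg_iff.2 fun f hf => ?_, key⟩
  have h1 := hd _ (leftTrans_mem_vanishing (S.inv_mem hg) hf)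
  rwa [key, der_leftTrans, ev_leftTrans, inv_mul_cancel] at h1

/-- On an irreducible group, two functions with the same logarithmic derivative along the Lie
algebra are proportional. -/
theorem ev_mul_ev_eq_of_forall_der [IsAlgClosed K] [CharZero K]
    {S : Subgroup (LinearMap.GeneralLinearGroup K V)}
    (hS : (vanishing (S : Set (LinearMap.GeneralLinearGroup K V))).IsPrime)
    (f h : CoordPoly K V)
    (H : ∀ x ∈ lieAlg S, ∀ g ∈ S, ev g h * ev g (der x f) = ev g f * ev g (der x h))
    {g : LinearMap.GeneralLinearGroup K V} (hg : g ∈ S) :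
    ev g f * ev 1 h = ev g h * ev 1 f := by
  let I := vanishing (S : Set (LinearMap.GeneralLinearGroup K V))
  let R := CoordPoly K V ⧸ I
  have hR : ∀ p q : CoordPoly K V, Ideal.Quotient.mk I p = Ideal.Quotient.mk I q ↔
      ∀ g ∈ S, ev g p = ev g q := by
    intro p q
    rw [Ideal.Quotient.eq, mem_vanishing]
    simp [sub_eq_zero]
  by_cases hh : Ideal.Quotient.mk I h = 0
  · rw [Ideal.Quotient.eq_zero_iff_mem, mem_vanishing] at hh
    rw [hh g hg, hh 1 S.one_mem]; simp
  have hev : ∀ g ∈ S, ∀ p ∈ I, ev g p = 0 := fun g hg p hp => mem_vanishing.1 hp g hg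
  obtain ⟨c, hc⟩ := exists_eq_smul_of_forall_derivation (K := K) (f := Ideal.Quotient.mk I f) hh
    (by
      intro D
      obtain ⟨a, ha⟩ := Ideal.Quotient.mk_surjective (D (Ideal.Quotient.mk I f))
      obtain ⟨b, hb⟩ := Ideal.Quotient.mk_surjective (D (Ideal.Quotient.mk I h))
      rw [← ha, ← hb, ← map_mul, ← map_mul, hR]
      intro g hg
      let e : R →ₐ[K] K := Ideal.Quotient.liftₐ I (ev g) (hev g hg)
      have he : ∀ p, e (Ideal.Quotient.mk I p) = ev g p := fun p => rfl
      -- At the point g the derivation D agrees with a left invariant field, with x depending on g.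
      -- Elements of R are determined by their values on S, so the pointwise hypothesis is enough.
      obtain ⟨x, hx, hxp⟩ := exists_lieAlg_ev_eq (S := S)
        (fun p => e (D (Ideal.Quotient.mk I p))) hg (fun p q => by simp)
        (fun c => by
          have : Ideal.Quotient.mk I (C c) = algebraMap K R c := rfl
          rw [this, Derivation.map_algebraMap, map_zero])
        (fun p q => by simp [he])
        (fun p hp => by rw [Ideal.Quotient.eq_zero_iff_mem.2 hp, map_zero, map_zero])
      have h1 := hxp f
      have h2 := hxp h
      simp only [← ha, ← hb, he] at h1 h2
      rw [map_mul, map_mul, h1, h2]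
      exact H x hx g hg)
  have h3 : ∀ g ∈ S, ev g f = c * ev g h := by
    have : Ideal.Quotient.mk I f = Ideal.Quotient.mk I (c • h) := hc
    rw [hR] at this
    intro g hg
    rw [this g hg, map_smul, smul_eq_mul]
  rw [h3 g hg, h3 1 S.one_mem]
  ring

end LieAlgebra

/-! ### Noetherian groups with continuous left translations. -/

section TranslationInvariantTopology

open TopologicalSpace

variable {T : Type*} [TopologicalSpace T] [Group T]

/-- A connected Noetherian group with continuous left translations is irreducible. -/
theorem isPreirreducible_univ_of_continuous_mul_left [NoetherianSpace T] [PreconnectedSpace T]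
    (hl : ∀ a : T, Continuous fun x => a * x) : IsPreirreducible (Set.univ : Set T) := by
  have hclosed := isClosed_irreducibleComponent (x := (1 : T))
  have hirr := isIrreducible_irreducibleComponent (x := (1 : T))
  obtain ⟨U, hU, ⟨u, hu⟩, hUZ⟩ := NoetherianSpace.exists_isOpen_nonempty_subset_irreducibleComponent
    _ (irreducibleComponent_mem_irreducibleComponents (1 : T))
  set Z := irreducibleComponent (1 : T)
  -- Some nonempty open U lies in Z. Translating U by a = yu⁻¹ gives an open neighbourhood of y
  -- inside aZ. The irreducible closed set aZ contains a dense part of Z, hence Z, and equals Z by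
  -- maximality.
  have hopen : IsOpen Z := by
    rw [isOpen_iff_forall_mem_open]
    intro y hy
    let a := y * u⁻¹
    let W := (fun x => a⁻¹ * x) ⁻¹' Z
    have haU : IsOpen ((fun x => a⁻¹ * x) ⁻¹' U) := hU.preimage (hl _)
    have hya : y ∈ (fun x => a⁻¹ * x) ⁻¹' U := by simpa [a] using hu
    have hWirr : IsPreirreducible W := by
      have : W = (fun x => a * x) '' Z := by
        ext x
        constructor
        · intro hx
          exact ⟨a⁻¹ * x, hx, by simp⟩
        · rintro ⟨z, hz, rfl⟩
          simpa [W] using hz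
      rw [this]
      exact hirr.2.image _ (hl a).continuousOn
    have hdense : Z ⊆ closure (Z ∩ U) :=
      subset_closure_inter_of_isPreirreducible_of_isOpen hirr.2 hU ⟨u, hUZ hu, hu⟩
    obtain ⟨z, hz1, hz2, hz3⟩ := mem_closure_iff.1 (hdense hy) _ haU hya
    have hZW : Z ⊆ W := by
      have h1 : Z ⊆ closure (Z ∩ ((fun x => a⁻¹ * x) ⁻¹' U)) :=
        subset_closure_inter_of_isPreirreducible_of_isOpen hirr.2 haU ⟨z, hz2, hz1⟩
      refine h1.trans (closure_minimal ?_ (hclosed.preimage (hl _)))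
      rintro x ⟨-, hx⟩
      exact hUZ hx
    have hWZ : W = Z := eq_irreducibleComponent hWirr hZW
    refine ⟨_, fun x hx => ?_, haU, hya⟩
    rw [← hWZ]
    exact hUZ hx
  have huniv : Z = Set.univ :=
    (isClopen_iff.1 ⟨hclosed, hopen⟩).resolve_left (Set.nonempty_iff_ne_empty.1 hirr.1)
  rw [← huniv]
  exact hirr.2

/-- There are finitely many irreducible components, and each connected component contains one of
them. -/
theorem finite_connectedComponents_of_noetherianSpace (T : Type*) [TopologicalSpace T]
    [NoetherianSpace T] : Finite (ConnectedComponents T) := by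
  have hfin : (irreducibleComponents T).Finite := NoetherianSpace.finite_irreducibleComponents
  have : Finite (irreducibleComponents T) := hfin
  let x : irreducibleComponents T → T := fun Z => Z.2.1.nonempty.some
  refine Finite.of_surjective (fun Z => ConnectedComponents.mk (x Z)) fun c => ?_
  obtain ⟨t, rfl⟩ := ConnectedComponents.surjective_coe c
  refine ⟨⟨_, irreducibleComponent_mem_irreducibleComponents t⟩, ?_⟩
  rw [ConnectedComponents.coe_eq_coe, connectedComponent_eq_iff_mem]
  have h1 : IsPreconnected (irreducibleComponent t) :=
    isIrreducible_irreducibleComponent.2.isPreconnected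
  refine h1.subset_connectedComponent mem_irreducibleComponent ?_
  exact Set.Nonempty.some_mem _

/-- In a Noetherian group with continuous left translations, a subgroup containing the connected
component of the identity has finite index. -/
theorem finiteIndex_of_connectedComponent_subset [NoetherianSpace T]
    (hl : ∀ a : T, Continuous fun x => a * x) (C : Subgroup T)
    (hC : connectedComponent (1 : T) ⊆ C) : C.FiniteIndex := by
  have := finite_connectedComponents_of_noetherianSpace T
  have hmem : ∀ a b : T, (a : ConnectedComponents T) = b → a⁻¹ * b ∈ C := by
    intro a b hab
    rw [ConnectedComponents.coe_eq_coe] at hab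
    have hb : b ∈ connectedComponent a := hab ▸ mem_connectedComponent
    refine hC ((isPreconnected_connectedComponent.image (fun x => a⁻¹ * x)
      (hl _).continuousOn).subset_connectedComponent ⟨a, mem_connectedComponent, by simp⟩
      ⟨b, hb, rfl⟩)
  have hfin : Finite (T ⧸ C) := by
    refine Finite.of_injective (β := ConnectedComponents T)
      (fun q => ((Quotient.out q : T) : ConnectedComponents T)) fun q r h => ?_
    rw [← QuotientGroup.out_eq' q, ← QuotientGroup.out_eq' r, QuotientGroup.eq]
    exact hmem _ _ h
  exact Subgroup.finiteIndex_of_finite_quotient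

end TranslationInvariantTopology

/-! ### The Zariski topology on GL(V): closures, components, irreducibility. -/

section ZariskiTopology

open TopologicalSpace Module

attribute [local instance] zariskiTopology

variable {K : Type*} [Field K] {V : Type*} [AddCommGroup V] [Module K V]

theorem continuous_subgroup_mul_left (S : Subgroup (LinearMap.GeneralLinearGroup K V)) (a : S) :
    Continuous fun x : S => a * x :=
  Continuous.subtype_mk ((continuous_mul_left (a : LinearMap.GeneralLinearGroup K V)).comp
    continuous_subtype_val) _

theorem identityComponent_le (M : Subgroup (LinearMap.GeneralLinearGroup K V)) :
    identityComponent M ≤ M :=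
  connectedComponentIn_subset _ _

theorem le_identityComponent {S M : Subgroup (LinearMap.GeneralLinearGroup K V)}
    (hS : IsZariskiConnected S) (h : S ≤ M) : S ≤ identityComponent M :=
  hS.2.subset_connectedComponentIn S.one_mem h

theorem isZariskiConnected_identityComponent (M : Subgroup (LinearMap.GeneralLinearGroup K V)) :
    IsZariskiConnected (identityComponent M) :=
  isConnected_connectedComponentIn_iff.2 M.one_mem

theorem identityComponent_eq_self {S : Subgroup (LinearMap.GeneralLinearGroup K V)}
    (hS : IsZariskiConnected S) : identityComponent S = S :=
  le_antisymm (identityComponent_le S) (le_identityComponent hS le_rfl)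

theorem continuous_conj (m : LinearMap.GeneralLinearGroup K V) :
    Continuous fun s : LinearMap.GeneralLinearGroup K V => m * s * m⁻¹ :=
  (continuous_mul_right m⁻¹).comp (continuous_mul_left m)

theorem isClosed_zariskiClosure (Γ : Subgroup (LinearMap.GeneralLinearGroup K V)) :
    IsClosed (zariskiClosure Γ : Set (LinearMap.GeneralLinearGroup K V)) :=
  isClosed_closure

theorem le_zariskiClosure (Γ : Subgroup (LinearMap.GeneralLinearGroup K V)) :
    Γ ≤ zariskiClosure Γ :=
  subset_closure

theorem zariskiClosure_le {Γ S : Subgroup (LinearMap.GeneralLinearGroup K V)} (h : Γ ≤ S)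
    (hS : IsClosed (S : Set (LinearMap.GeneralLinearGroup K V))) : zariskiClosure Γ ≤ S :=
  closure_minimal h hS

theorem isClosed_identityComponent {M : Subgroup (LinearMap.GeneralLinearGroup K V)}
    (hM : IsClosed (M : Set (LinearMap.GeneralLinearGroup K V))) :
    IsClosed (identityComponent M : Set (LinearMap.GeneralLinearGroup K V)) := by
  refine isClosed_of_closure_subset ?_
  have h1 : closure (identityComponent M : Set (LinearMap.GeneralLinearGroup K V)) ⊆ M :=
    closure_minimal (identityComponent_le M) hM
  exact (isZariskiConnected_identityComponent M).2.closure.subset_connectedComponentIn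
    (subset_closure (identityComponent M).one_mem) h1

variable [FiniteDimensional K V]

/-- Sending g to the kernel of evaluation at g induces the Zariski topology from the spectrum of a
Noetherian ring. -/
theorem noetherianSpace_generalLinearGroup :
    NoetherianSpace (LinearMap.GeneralLinearGroup K V) := by
  let i : LinearMap.GeneralLinearGroup K V → PrimeSpectrum (CoordPoly K V) :=
    fun g => ⟨RingHom.ker (ev g), RingHom.ker_isPrime _⟩
  have hi : Topology.IsInducing i := by
    refine ⟨?_⟩
    refine TopologicalSpace.ext_isClosed fun Z => ?_
    rw [isClosed_iff_exists_coordPoly, isClosed_induced_iff]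
    constructor
    · rintro ⟨T, rfl⟩
      refine ⟨PrimeSpectrum.zeroLocus T, PrimeSpectrum.isClosed_zeroLocus T, ?_⟩
      ext g
      rfl
    · rintro ⟨Y, hY, rfl⟩
      obtain ⟨T, rfl⟩ := (PrimeSpectrum.isClosed_iff_zeroLocus Y).1 hY
      exact ⟨T, rfl⟩
  exact hi.noetherianSpace

/-- A connected subgroup is irreducible, so if f h vanishes on it, one of the two closed zero sets
is everything. -/
theorem isPrime_vanishing {S : Subgroup (LinearMap.GeneralLinearGroup K V)}
    (hS : IsZariskiConnected S) :
    (vanishing (S : Set (LinearMap.GeneralLinearGroup K V))).IsPrime := by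
  have := noetherianSpace_generalLinearGroup (K := K) (V := V)
  have : PreconnectedSpace S := Subtype.preconnectedSpace hS.2
  have : NoetherianSpace S := NoetherianSpace.set _
  have hirr := isPreirreducible_univ_of_continuous_mul_left (continuous_subgroup_mul_left S)
  rw [isPreirreducible_iff_isClosed_union_isClosed] at hirr
  refine ⟨?_, ?_⟩
  · intro h
    have h1 : (1 : CoordPoly K V) ∈ vanishing (S : Set (LinearMap.GeneralLinearGroup K V)) :=
      h ▸ Submodule.mem_top
    simpa using mem_vanishing.1 h1 1 S.one_mem
  · intro f h hfh
    have hcl : ∀ p : CoordPoly K V,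
        IsClosed {x : S | ev (x : LinearMap.GeneralLinearGroup K V) p = 0} :=
      fun p => (isClosed_setOf_ev_eq_zero' p).preimage continuous_subtype_val
    rw [mem_vanishing] at hfh
    rcases hirr _ _ (hcl f) (hcl h) (fun x _ => by
      have := hfh x x.2
      rw [map_mul] at this
      exact mul_eq_zero.1 this) with h1 | h1
    · refine Or.inl (mem_vanishing.2 fun g hg => ?_)
      have h2 := h1 (Set.mem_univ (⟨g, hg⟩ : S))
      exact h2
    · refine Or.inr (mem_vanishing.2 fun g hg => ?_)
      have h2 := h1 (Set.mem_univ (⟨g, hg⟩ : S))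
      exact h2

theorem finiteIndex_identityComponent (M : Subgroup (LinearMap.GeneralLinearGroup K V)) :
    ((identityComponent M).subgroupOf M).FiniteIndex := by
  have := noetherianSpace_generalLinearGroup (K := K) (V := V)
  have : NoetherianSpace M := NoetherianSpace.set _
  refine finiteIndex_of_connectedComponent_subset (continuous_subgroup_mul_left M) _ ?_
  intro x hx
  change (x : LinearMap.GeneralLinearGroup K V) ∈
    connectedComponentIn (M : Set (LinearMap.GeneralLinearGroup K V)) 1
  rw [connectedComponentIn_eq_image M.one_mem]
  exact ⟨x, hx, rfl⟩

/-- GL(V) is in general not a topological group for this topology, so continuity in the conjugating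
variable does not follow from that of translations. It holds because the entries of m s m⁻¹ are
regular in m. -/
theorem continuous_conj_apply (s : LinearMap.GeneralLinearGroup K V) :
    Continuous fun m : LinearMap.GeneralLinearGroup K V => m * s * m⁻¹ := by
  refine continuous_of_pullback _ fun φ => ⟨?_, ?_⟩
  · exact (mem_regularFunctions_iff _).2 ⟨conjPoly (s : End K V) φ, fun g => by
      rw [ev_conjPoly]; simp⟩
  · refine (mem_regularFunctions_iff _).2
      ⟨conjPoly ((s⁻¹ : LinearMap.GeneralLinearGroup K V) : End K V) φ, fun g => ?_⟩
    rw [ev_conjPoly, mul_inv_rev, mul_inv_rev, inv_inv, ← mul_assoc]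
    simp only [Units.val_mul]

theorem isClosed_singleton_generalLinearGroup (a : LinearMap.GeneralLinearGroup K V) :
    IsClosed ({a} : Set (LinearMap.GeneralLinearGroup K V)) := by
  have : ({a} : Set (LinearMap.GeneralLinearGroup K V)) =
      {g | ∀ f ∈ Set.range fun φ : Dual K (End K V) => lin φ - MvPolynomial.C (φ a), ev g f = 0} := by
    ext g
    simp only [Set.mem_singleton_iff, Set.forall_mem_range, Set.mem_ofPred_eq, map_sub, ev_lin,
      ← MvPolynomial.algebraMap_eq, AlgHom.commutes, Algebra.algebraMap_self, RingHom.id_apply]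
    constructor
    · rintro rfl φ; exact sub_self _
    · intro h
      refine Units.ext (sub_eq_zero.1 ((Module.forall_dual_apply_eq_zero_iff K _).1 fun φ => ?_))
      rw [map_sub]; exact h φ
  rw [this]
  exact isClosed_setOf_ev_eq_zero _

/-- A finite group has trivial Lie algebra. -/
theorem lieAlg_eq_bot_of_finite {S : Subgroup (LinearMap.GeneralLinearGroup K V)}
    (hS : (S : Set (LinearMap.GeneralLinearGroup K V)).Finite) {x : End K V}
    (hx : x ∈ lieAlg S) : x = 0 := by
  have hcl : IsClosed ((S : Set (LinearMap.GeneralLinearGroup K V)) \ {1}) := by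
    have : ((S : Set (LinearMap.GeneralLinearGroup K V)) \ {1}) =
        ⋃ a ∈ (S : Set (LinearMap.GeneralLinearGroup K V)) \ {1}, {a} :=
      (Set.biUnion_of_singleton _).symm
    rw [this]
    exact hS.sdiff.isClosed_biUnion fun a _ => isClosed_singleton_generalLinearGroup a
  have h1 : ∃ f ∈ vanishing ((S : Set (LinearMap.GeneralLinearGroup K V)) \ {1}), ev 1 f ≠ 0 := by
    by_contra! h
    exact (mem_of_isClosed hcl h).2 rfl
  obtain ⟨f, hf, hf1⟩ := h1
  rw [mem_vanishing] at hf
  refine (Module.forall_dual_apply_eq_zero_iff K _).1 fun φ => ?_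
  -- With f vanishing on S except at 1, the product vanishes on S, and its derivative at 1 along x
  -- is f(1) φ(x).
  have h2 : f * (lin φ - MvPolynomial.C (φ 1)) ∈
      vanishing (S : Set (LinearMap.GeneralLinearGroup K V)) := by
    rw [mem_vanishing]
    intro g hg
    by_cases hg1 : g = 1
    · subst hg1
      simp [← MvPolynomial.algebraMap_eq]
    · rw [map_mul, hf g ⟨hg, hg1⟩, zero_mul]
  have h3 := mem_lieAlg_iff.1 hx _ h2
  rw [Derivation.leibniz, map_sub, der_lin, ← MvPolynomial.algebraMap_eq,
    Derivation.map_algebraMap] at h3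
  simpa [hf1] using h3

end ZariskiTopology

/-! ### Passing between stability under a group and under its Lie algebra. -/

section Stable

open MvPolynomial Module

attribute [local instance] zariskiTopology LieRing.ofAssociativeRing

variable {K : Type*} [Field K] {V : Type*} [AddCommGroup V] [Module K V] [FiniteDimensional K V]

/-- The minors `a ↦ det (τ ∘ r a ∘ ι)`, where `ι` is the inclusion of a submodule `W`, of a rational
representation `r` are regular, and they are eigenfunctions of the elements of the Lie algebra
preserving `W`. -/
theorem exists_ev_eq_det {F : Type*} [AddCommGroup F] [Module K F]
    (r : LinearMap.GeneralLinearGroup K V → F →ₗ[K] F) (dr : End K V → F →ₗ[K] F)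
    (hp : ∀ (v : F) (ℓ : Dual K F), ∃ p : CoordPoly K V, (∀ g, ev g p = ℓ (r g v)) ∧
      ∀ x g, ev g (der x p) = ℓ (r g (dr x v)))
    (W : Submodule K F) [FiniteDimensional K W] (τ : F →ₗ[K] W) : ∃ q : CoordPoly K V,
      (∀ a, ev a q = LinearMap.det (τ ∘ₗ r a ∘ₗ W.subtype)) ∧
      ∀ x (hx : ∀ w ∈ W, dr x w ∈ W) a,
        ev a (der x q) = LinearMap.trace K W ((dr x).restrict hx) * ev a q := by
  choose p hp1 hp2 using hp
  let b := finBasis K W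
  let A : Matrix (Fin (finrank K W)) (Fin (finrank K W)) (CoordPoly K V) :=
    Matrix.of fun i j => p (b j) (b.coord i ∘ₗ τ)
  refine ⟨A.det, fun a => ?_, fun x hx a => ?_⟩
  · rw [← LinearMap.det_toMatrix b, AlgHom.map_det]
    congr 1
    ext i j
    simp [A, LinearMap.toMatrix_apply, hp1]
  · let C := LinearMap.toMatrix b b ((dr x).restrict hx)
    rw [LinearMap.trace_eq_matrix_trace K b]
    -- Differentiating r along x composes it on the right with dr x. On W this multiplies A by the
    -- matrix C of dr x restricted to W, as Jacobi's formula requires.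
    refine derivation_det (ev a : CoordPoly K V →+* K) (der x) A C ?_
    ext i j
    simp only [Matrix.map_apply, Matrix.mul_apply, RingHom.coe_coe, A, Matrix.of_apply, hp1, hp2]
    have h1 : dr x (b j) = ∑ k, C k j • (b k : F) := by
      have h2 := b.sum_repr ((dr x).restrict hx (b j))
      have h3 := congrArg W.subtype h2
      simp only [map_sum, map_smul, Submodule.subtype_apply, LinearMap.coe_restrict_apply] at h3
      rw [← h3]
      simp [C, LinearMap.toMatrix_apply]
    rw [h1]
    simp only [map_sum, map_smul, smul_eq_mul, mul_comm]

/-- A submodule of a rational representation which is stable under the Lie algebra of an irreducible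
group `S` is stable under `S`. -/
theorem apply_mem_of_forall_lieAlg [IsAlgClosed K] [CharZero K]
    {S : Subgroup (LinearMap.GeneralLinearGroup K V)}
    (hS : (vanishing (S : Set (LinearMap.GeneralLinearGroup K V))).IsPrime)
    {F : Type*} [AddCommGroup F] [Module K F] (r : LinearMap.GeneralLinearGroup K V → F →ₗ[K] F)
    (hr1 : r 1 = LinearMap.id) (hrinj : ∀ g, Function.Injective (r g)) (dr : End K V → F →ₗ[K] F)
    (hp : ∀ (v : F) (ℓ : Dual K F), ∃ p : CoordPoly K V, (∀ g, ev g p = ℓ (r g v)) ∧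
      ∀ x g, ev g (der x p) = ℓ (r g (dr x v)))
    (W : Submodule K F) [FiniteDimensional K W] (hW : ∀ x ∈ lieAlg S, ∀ w ∈ W, dr x w ∈ W)
    {g : LinearMap.GeneralLinearGroup K V} (hg : g ∈ S) {w : F} (hw : w ∈ W) : r g w ∈ W := by
  choose q hA hder using exists_ev_eq_det r dr hp W
  -- Whatever τ is, the minor has logarithmic derivative equal to the trace of dr x on W. All minors
  -- are therefore proportional on S.
  have hconst : ∀ τ τ', ∀ a ∈ S, ev a (q τ) * ev 1 (q τ') = ev a (q τ') * ev 1 (q τ) :=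
    fun τ τ' a ha => ev_mul_ev_eq_of_forall_der hS _ _
      (fun x hx c _ => by rw [hder τ x (hW x hx), hder τ' x (hW x hx)]; ring) ha
  by_contra hcon
  let ρ : W →ₗ[K] F := r g ∘ₗ W.subtype
  have hρ : Function.Injective ρ := (hrinj g).comp Subtype.val_injective
  have hdim : finrank K (LinearMap.range ρ) = finrank K W := LinearMap.finrank_range_of_inj hρ
  have hnot : ¬ W ≤ LinearMap.range ρ := by
    intro hle
    have := Submodule.eq_of_le_of_finrank_eq hle hdim.symm
    exact hcon (this ▸ ⟨⟨w, hw⟩, rfl⟩)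
  obtain ⟨w₀, hw₀, hw₀'⟩ := Set.not_subset.1 hnot
  obtain ⟨σ, hσ⟩ := LinearMap.exists_leftInverse_of_injective ρ (LinearMap.ker_eq_bot.2 hρ)
  obtain ⟨σ₁, hσ₁⟩ := LinearMap.exists_leftInverse_of_injective W.subtype (Submodule.ker_subtype W)
  obtain ⟨ψ, hψ, hψ'⟩ := Submodule.exists_le_ker_of_notMem hw₀'
  -- The left inverse σ of r g on W is corrected to kill a vector w₀ of W outside r g W. The minor
  -- of τ is then 1 at g and 0 at the identity, while that of the retraction σ₁ is 1 at the
  -- identity, contradicting proportionality.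
  let τ : F →ₗ[K] W := σ - (ψ w₀)⁻¹ • ψ.smulRight (σ w₀)
  have h1 : τ ∘ₗ ρ = LinearMap.id := by
    ext v : 1
    have h2 : ψ (ρ v) = 0 := hψ' ⟨v, rfl⟩
    have h3 : σ (ρ v) = v := LinearMap.congr_fun hσ v
    simp [τ, h2, h3]
  have h2 : τ w₀ = 0 := by simp [τ, smul_smul, inv_mul_cancel₀ hψ]
  have h3 := hconst τ σ₁ g hg
  have h4 : LinearMap.det (τ ∘ₗ W.subtype) = 0 := by
    rw [LinearMap.det_eq_zero_iff_ker_ne_bot]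
    refine (Submodule.ne_bot_iff _).2 ⟨⟨w₀, hw₀⟩, h2, fun h => hw₀' ?_⟩
    have h5 : w₀ = 0 := congrArg Subtype.val h
    rw [h5]; exact zero_mem _
  rw [hA, hA, hA, hA, hr1] at h3
  simp only [LinearMap.id_comp] at h3
  rw [hσ₁, h4,
    show r g ∘ₗ W.subtype = ρ from rfl, h1] at h3
  simp at h3

/-- A subspace stable under the Lie algebra is stable under the group. -/
theorem apply_mem_of_lieAlg_stable [IsAlgClosed K] [CharZero K]
    {S : Subgroup (LinearMap.GeneralLinearGroup K V)}
    (hS : (vanishing (S : Set (LinearMap.GeneralLinearGroup K V))).IsPrime)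
    {W : Submodule K V} (hW : ∀ x ∈ lieAlg S, ∀ w ∈ W, x w ∈ W)
    {g : LinearMap.GeneralLinearGroup K V} (hg : g ∈ S) {w : V} (hw : w ∈ W) :
    (g : End K V) w ∈ W := by
  refine apply_mem_of_forall_lieAlg hS (fun g => (g : End K V)) rfl (fun g => ?_) (fun x => x)
    (fun v ℓ => ⟨lin (ℓ ∘ₗ LinearMap.applyₗ v), fun g => by simp, fun x g => by simp⟩) W hW hg hw
  exact (LinearMap.GeneralLinearGroup.generalLinearEquiv K V g).injective

/-- A subspace of `End V` stable under bracket with the Lie algebra is stable under conjugation by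
the group. -/
theorem conj_mem_of_lieAlg_stable [IsAlgClosed K] [CharZero K]
    {S : Subgroup (LinearMap.GeneralLinearGroup K V)}
    (hS : (vanishing (S : Set (LinearMap.GeneralLinearGroup K V))).IsPrime)
    {W : Submodule K (End K V)} (hW : ∀ x ∈ lieAlg S, ∀ w ∈ W, x * w - w * x ∈ W)
    {g : LinearMap.GeneralLinearGroup K V} (hg : g ∈ S) {w : End K V} (hw : w ∈ W) :
    (g : End K V) * w * ((g⁻¹ : LinearMap.GeneralLinearGroup K V) : End K V) ∈ W := by
  have hr : ∀ (g : LinearMap.GeneralLinearGroup K V) (a : End K V),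
      (LinearMap.mulLeft K (g : End K V) ∘ₗ
        LinearMap.mulRight K ((g⁻¹ : LinearMap.GeneralLinearGroup K V) : End K V)) a =
      (g : End K V) * a * ((g⁻¹ : LinearMap.GeneralLinearGroup K V) : End K V) :=
    fun g a => (mul_assoc _ _ _).symm
  rw [← hr]
  refine apply_mem_of_forall_lieAlg hS
    (fun g => LinearMap.mulLeft K (g : End K V) ∘ₗ
      LinearMap.mulRight K ((g⁻¹ : LinearMap.GeneralLinearGroup K V) : End K V))
    (by ext; simp) (fun g => ?_) (fun x => LinearMap.mulLeft K x - LinearMap.mulRight K x)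
    (fun v ℓ => ⟨conjPoly v ℓ, fun g => ?_, fun x g => ?_⟩) W hW hg hw
  · exact (g.mulLeft_bijective).injective.comp (g⁻¹).mulRight_bijective.injective
  · rw [ev_conjPoly, hr]
  · rw [ev_der_conjPoly, hr]; rfl

/-- A subspace stable under a group is stable under its Lie algebra. -/
theorem lieAlg_apply_mem_of_stable {S : Subgroup (LinearMap.GeneralLinearGroup K V)}
    {W : Submodule K V} (hW : ∀ g ∈ S, ∀ w ∈ W, (g : End K V) w ∈ W)
    {x : End K V} (hx : x ∈ lieAlg S) {w : V} (hw : w ∈ W) : x w ∈ W := by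
  by_contra hcon
  obtain ⟨ψ, hψ, hψ'⟩ := Submodule.exists_le_ker_of_notMem hcon
  have h1 : lin (ψ ∘ₗ LinearMap.applyₗ w) ∈
      vanishing (S : Set (LinearMap.GeneralLinearGroup K V)) := by
    rw [mem_vanishing]
    intro g hg
    rw [ev_lin]
    exact hψ' (hW g hg w hw)
  have h2 := mem_lieAlg_iff.1 hx _ h1
  rw [der_lin, ev_lin] at h2
  exact hψ (by simpa using h2)

/-- Left invariant fields are permuted by right translations through the adjoint action; this gives
the adjoint action on Lie algebras in `conj_mem_lieAlg`. -/
theorem der_rightTrans (x : End K V) (g : LinearMap.GeneralLinearGroup K V) (f : CoordPoly K V) :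
    der x (rightTrans g f) = rightTrans g
      (der (((g⁻¹ : LinearMap.GeneralLinearGroup K V) : End K V) * x * (g : End K V)) f) := by
  induction f using coordPoly_induction with
  | hC c => simp [← MvPolynomial.algebraMap_eq]
  | hadd f g hf hg => simp [hf, hg]
  | hmul f g hf hg => simp [hf, hg]
  | hlin φ =>
    simp only [rightTrans_lin, der_lin]
    congr 1; ext a
    simp only [LinearMap.comp_apply, LinearMap.mulRight_apply]
    simp only [← mul_assoc]
    rw [mul_assoc a (g : End K V), Units.mul_inv, mul_one]
  | hlinInv φ =>
    simp only [rightTrans_linInv, der_linInv, map_neg]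
    congr 2; ext a
    simp only [LinearMap.comp_apply, LinearMap.mulLeft_apply]
    rw [mul_assoc, mul_assoc, ← mul_assoc (g : End K V), Units.mul_inv, one_mul]

/-- An element normalizing `S` normalizes the Lie algebra of `S`. -/
theorem conj_mem_lieAlg {S : Subgroup (LinearMap.GeneralLinearGroup K V)}
    {m : LinearMap.GeneralLinearGroup K V} (hm : ∀ s ∈ S, m * s * m⁻¹ ∈ S) {y : End K V}
    (hy : y ∈ lieAlg S) :
    (m : End K V) * y * ((m⁻¹ : LinearMap.GeneralLinearGroup K V) : End K V) ∈ lieAlg S := by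
  rw [mem_lieAlg_iff] at hy ⊢
  intro f hf
  have h1 := hy (leftTrans m (rightTrans m⁻¹ f)) (mem_vanishing.2 fun s hs => by
    rw [ev_leftTrans, ev_rightTrans]
    exact mem_vanishing.1 hf _ (hm s hs))
  rwa [der_leftTrans, ev_leftTrans, der_rightTrans, ev_rightTrans, mul_one, mul_inv_cancel,
    inv_inv] at h1

/-- If `M` normalizes `S` then the Lie algebra of `M` normalizes that of `S`. -/
theorem commutator_mem_lieAlg {S M : Subgroup (LinearMap.GeneralLinearGroup K V)}
    (hMS : ∀ m ∈ M, ∀ s ∈ S, m * s * m⁻¹ ∈ S) {x y : End K V} (hx : x ∈ lieAlg M)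
    (hy : y ∈ lieAlg S) : x * y - y * x ∈ lieAlg S := by
  by_contra hcon
  obtain ⟨ψ, hψ, hψ'⟩ := Submodule.exists_le_ker_of_notMem
    (p := (lieAlg S).toSubmodule) hcon
  -- Since ψ kills Lie S, the function m ↦ ψ(m y m⁻¹) vanishes on M, and its derivative at 1 along x
  -- is ψ(xy - yx).
  have h1 : conjPoly y ψ ∈ vanishing (M : Set (LinearMap.GeneralLinearGroup K V)) := by
    rw [mem_vanishing]
    intro m hm
    rw [ev_conjPoly]
    exact hψ' (conj_mem_lieAlg (hMS m hm) hy)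
  have h2 := mem_lieAlg_iff.1 hx _ h1
  rw [ev_der_conjPoly] at h2
  exact hψ (by simpa using h2)

/-- Right translation of polynomials is a rational representation with differential `der`, as
`apply_mem_of_forall_lieAlg` demands. The induction multiplies by one coordinate at a time: a
translated coordinate is a finite combination of fixed ones, with coefficients regular in g. -/
theorem exists_ev_eq_dual_rightTrans (f : CoordPoly K V) :
    ∀ ℓ : Dual K (CoordPoly K V), ∃ p : CoordPoly K V, (∀ g, ev g p = ℓ (rightTrans g f)) ∧
      ∀ x g, ev g (der x p) = ℓ (rightTrans g (der x f)) := by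
  have hlin : ∀ (f : CoordPoly K V) (φ : Dual K (End K V)),
      (∀ ℓ : Dual K (CoordPoly K V), ∃ p : CoordPoly K V, (∀ g, ev g p = ℓ (rightTrans g f)) ∧
        ∀ x g, ev g (der x p) = ℓ (rightTrans g (der x f))) →
      ∀ ℓ : Dual K (CoordPoly K V), ∃ p : CoordPoly K V,
        (∀ g, ev g p = ℓ (rightTrans g (f * lin φ))) ∧
        ∀ x g, ev g (der x p) = ℓ (rightTrans g (der x (f * lin φ))) := by
    intro f φ hf ℓ
    let m : Fin (finrank K (End K V)) → CoordPoly K V :=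
      fun j => lin (φ ∘ₗ LinearMap.mulRight K (endBasis K V j))
    choose p hp hp' using fun j => hf (ℓ ∘ₗ LinearMap.mulRight K (m j))
    have hexp : ∀ a : End K V, lin (φ ∘ₗ LinearMap.mulRight K a) =
        ∑ j, (endBasis K V).coord j a • m j := by
      intro a
      simp only [m, ← map_smul, ← map_sum]
      refine congrArg lin (LinearMap.ext fun c => ?_)
      simp only [LinearMap.comp_apply, LinearMap.mulRight_apply]
      conv_lhs => rw [← (endBasis K V).sum_repr a, Finset.mul_sum, map_sum]
      simp
    have key : ∀ (g : LinearMap.GeneralLinearGroup K V) (q : CoordPoly K V) (a : End K V),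
        ℓ (rightTrans g q * lin (φ ∘ₗ LinearMap.mulRight K a)) =
          ∑ j, (endBasis K V).coord j a * (ℓ ∘ₗ LinearMap.mulRight K (m j)) (rightTrans g q) := by
      intro g q a
      rw [hexp, Finset.mul_sum, map_sum]
      simp
    refine ⟨∑ j, p j * lin ((endBasis K V).coord j), fun g => ?_, fun x g => ?_⟩
    · rw [map_mul, rightTrans_lin, key]
      simp only [map_sum, map_mul, ev_lin, hp]
      exact Finset.sum_congr rfl fun j _ => mul_comm _ _
    · have h1 : (φ ∘ₗ LinearMap.mulRight K x) ∘ₗ LinearMap.mulRight K (g : End K V) =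
          φ ∘ₗ LinearMap.mulRight K ((g : End K V) * x) := by
        ext; simp [mul_assoc]
      rw [Derivation.leibniz, map_add, smul_eq_mul, smul_eq_mul, map_mul, map_mul, der_lin,
        rightTrans_lin, rightTrans_lin, h1, map_add, key, mul_comm (lin _), key,
        ← Finset.sum_add_distrib]
      simp only [map_sum, Derivation.leibniz, smul_eq_mul, map_add, map_mul, der_lin, ev_lin, hp,
        hp', LinearMap.comp_apply, LinearMap.mulRight_apply]
      exact Finset.sum_congr rfl fun j _ => by ring
  have hlinInv : ∀ (f : CoordPoly K V) (φ : Dual K (End K V)),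
      (∀ ℓ : Dual K (CoordPoly K V), ∃ p : CoordPoly K V, (∀ g, ev g p = ℓ (rightTrans g f)) ∧
        ∀ x g, ev g (der x p) = ℓ (rightTrans g (der x f))) →
      ∀ ℓ : Dual K (CoordPoly K V), ∃ p : CoordPoly K V,
        (∀ g, ev g p = ℓ (rightTrans g (f * linInv φ))) ∧
        ∀ x g, ev g (der x p) = ℓ (rightTrans g (der x (f * linInv φ))) := by
    intro f φ hf ℓ
    let m : Fin (finrank K (End K V)) → CoordPoly K V :=
      fun j => linInv (φ ∘ₗ LinearMap.mulLeft K (endBasis K V j))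
    choose p hp hp' using fun j => hf (ℓ ∘ₗ LinearMap.mulRight K (m j))
    have hexp : ∀ a : End K V, linInv (φ ∘ₗ LinearMap.mulLeft K a) =
        ∑ j, (endBasis K V).coord j a • m j := by
      intro a
      simp only [m, ← map_smul, ← map_sum]
      refine congrArg linInv (LinearMap.ext fun c => ?_)
      simp only [LinearMap.comp_apply, LinearMap.mulLeft_apply]
      conv_lhs => rw [← (endBasis K V).sum_repr a, Finset.sum_mul, map_sum]
      simp
    have key : ∀ (g : LinearMap.GeneralLinearGroup K V) (q : CoordPoly K V) (a : End K V),
        ℓ (rightTrans g q * linInv (φ ∘ₗ LinearMap.mulLeft K a)) =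
          ∑ j, (endBasis K V).coord j a * (ℓ ∘ₗ LinearMap.mulRight K (m j)) (rightTrans g q) := by
      intro g q a
      rw [hexp, Finset.mul_sum, map_sum]
      simp
    refine ⟨∑ j, p j * linInv ((endBasis K V).coord j), fun g => ?_, fun x g => ?_⟩
    · rw [map_mul, rightTrans_linInv, key]
      simp only [map_sum, map_mul, ev_linInv, hp]
      exact Finset.sum_congr rfl fun j _ => mul_comm _ _
    · have h1 : (φ ∘ₗ LinearMap.mulLeft K x) ∘ₗ
          LinearMap.mulLeft K ((g⁻¹ : LinearMap.GeneralLinearGroup K V) : End K V) =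
          φ ∘ₗ LinearMap.mulLeft K
            (x * ((g⁻¹ : LinearMap.GeneralLinearGroup K V) : End K V)) := by
        ext; simp
      rw [Derivation.leibniz, map_add, smul_eq_mul, smul_eq_mul, map_mul, map_mul, der_linInv,
        map_neg, rightTrans_linInv, rightTrans_linInv, h1, mul_neg, map_add, map_neg, key,
        mul_comm (linInv _), key, ← Finset.sum_neg_distrib, ← Finset.sum_add_distrib]
      simp only [map_sum, Derivation.leibniz, smul_eq_mul, map_add, map_mul, der_linInv, map_neg,
        ev_linInv, hp, hp', LinearMap.comp_apply, LinearMap.mulLeft_apply]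
      exact Finset.sum_congr rfl fun j _ => by ring
  induction f using MvPolynomial.induction_on with
  | C c =>
    intro ℓ
    refine ⟨C (ℓ (C c)), fun g => ?_, fun x g => ?_⟩ <;> simp [← MvPolynomial.algebraMap_eq]
  | add f f' hf hf' =>
    intro ℓ
    obtain ⟨p, hp, hp'⟩ := hf ℓ
    obtain ⟨q, hq, hq'⟩ := hf' ℓ
    exact ⟨p + q, fun g => by simp [hp, hq], fun x g => by simp [hp', hq']⟩
  | mul_X f i hf =>
    rcases i with i | i
    · rw [← lin_coord]; exact hlin f _ hf
    · rw [← linInv_coord]; exact hlinInv f _ hf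

variable (K V) in
/-- The space of polynomials of degree at most one. -/
noncomputable def affinePoly : Submodule K (CoordPoly K V) :=
  1 ⊔ (LinearMap.range lin ⊔ LinearMap.range linInv)

theorem one_le_affinePoly : 1 ≤ affinePoly K V := le_sup_left

theorem affinePoly_fg : (affinePoly K V).FG := by
  refine Submodule.FG.sup ?_ (Submodule.FG.sup ?_ ?_)
  · rw [Submodule.one_eq_span]; exact Submodule.fg_span_singleton _
  · exact Module.Finite.fg_top.map _ |> cast (by rw [LinearMap.range_eq_map])
  · exact Module.Finite.fg_top.map _ |> cast (by rw [LinearMap.range_eq_map])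

/-- Invariant fields send linear coordinates to linear coordinates, so they preserve the degree
filtration. This supplies finite dimensional stable spaces. -/
theorem der_mem_affinePoly_pow (x : End K V) (n : ℕ) :
    ∀ f ∈ affinePoly K V ^ n, der x f ∈ affinePoly K V ^ n := by
  induction n with
  | zero =>
    intro f hf
    rw [pow_zero, Submodule.mem_one] at hf
    obtain ⟨c, rfl⟩ := hf
    rw [Derivation.map_algebraMap]
    exact zero_mem _
  | succ n ih =>
    have h1 : ∀ f ∈ affinePoly K V, der x f ∈ affinePoly K V := by
      intro f hf
      rw [affinePoly, Submodule.mem_sup] at hf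
      obtain ⟨a, ha, b, hb, rfl⟩ := hf
      rw [Submodule.mem_sup] at hb
      obtain ⟨_, ⟨φ, rfl⟩, _, ⟨ψ, rfl⟩, rfl⟩ := hb
      rw [Submodule.mem_one] at ha
      obtain ⟨c, rfl⟩ := ha
      rw [map_add, map_add, Derivation.map_algebraMap, zero_add, der_lin, der_linInv]
      refine Submodule.mem_sup_right (add_mem (Submodule.mem_sup_left ⟨_, rfl⟩)
        (Submodule.mem_sup_right (neg_mem ⟨_, rfl⟩)))
    intro f hf
    rw [pow_succ] at hf ⊢
    induction hf using Submodule.mul_induction_on' with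
    | mem_mul_mem a ha b hb =>
      rw [Derivation.leibniz, smul_eq_mul, smul_eq_mul, mul_comm b]
      exact add_mem (Submodule.mul_mem_mul ha (h1 b hb)) (Submodule.mul_mem_mul (ih a ha) hb)
    | add a _ b _ ha hb => rw [map_add]; exact add_mem ha hb

theorem exists_mem_affinePoly_pow (f : CoordPoly K V) : ∃ n, f ∈ affinePoly K V ^ n := by
  induction f using coordPoly_induction with
  | hC c => exact ⟨0, by rw [pow_zero, Submodule.mem_one]; exact ⟨c, rfl⟩⟩
  | hadd f g hf hg =>
    obtain ⟨n, hn⟩ := hf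
    obtain ⟨m, hm⟩ := hg
    have h1 : affinePoly K V ^ n ≤ affinePoly K V ^ max n m :=
      pow_le_pow_right₀ one_le_affinePoly (le_max_left _ _)
    have h2 : affinePoly K V ^ m ≤ affinePoly K V ^ max n m :=
      pow_le_pow_right₀ one_le_affinePoly (le_max_right _ _)
    exact ⟨max n m, add_mem (h1 hn) (h2 hm)⟩
  | hmul f g hf hg =>
    obtain ⟨n, hn⟩ := hf
    obtain ⟨m, hm⟩ := hg
    exact ⟨n + m, by rw [pow_add]; exact Submodule.mul_mem_mul hn hm⟩
  | hlin φ => exact ⟨1, by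
      rw [pow_one]; exact Submodule.mem_sup_right (Submodule.mem_sup_left ⟨φ, rfl⟩)⟩
  | hlinInv φ => exact ⟨1, by
      rw [pow_one]; exact Submodule.mem_sup_right (Submodule.mem_sup_right ⟨φ, rfl⟩)⟩

/-- A connected group is determined by its Lie algebra. -/
theorem le_of_lieAlg_le [IsAlgClosed K] [CharZero K]
    {S M : Subgroup (LinearMap.GeneralLinearGroup K V)}
    (hM : (vanishing (M : Set (LinearMap.GeneralLinearGroup K V))).IsPrime)
    (hS : IsClosed (S : Set (LinearMap.GeneralLinearGroup K V))) (h : lieAlg M ≤ lieAlg S) :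
    M ≤ S := by
  intro g hg
  refine mem_of_isClosed hS fun f hf => ?_
  obtain ⟨n, hn⟩ := exists_mem_affinePoly_pow f
  let I : Submodule K (CoordPoly K V) :=
    (vanishing (S : Set (LinearMap.GeneralLinearGroup K V))).restrictScalars K
  -- Polynomials of bounded degree vanishing on S are stable under Lie S, hence under Lie M, hence
  -- under right translation by M. The value at 1 of the translate of f is f(g).
  let W := affinePoly K V ^ n ⊓ I
  have : FiniteDimensional K (affinePoly K V ^ n : Submodule K (CoordPoly K V)) :=
    Module.Finite.iff_fg.2 (affinePoly_fg.pow n)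
  have : FiniteDimensional K W := Submodule.finiteDimensional_inf_left _ _
  have h1 : rightTrans g f ∈ W := by
    refine apply_mem_of_forall_lieAlg hM (fun g => (rightTrans g).toLinearMap) ?_ ?_
      (fun x => (der x).toLinearMap) (fun v ℓ => exists_ev_eq_dual_rightTrans v ℓ) W ?_ hg ⟨hn, hf⟩
    · have : rightTrans (1 : LinearMap.GeneralLinearGroup K V) = AlgHom.id K _ := by
        refine coordPoly_algHom_ext (fun φ => ?_) fun φ => ?_
        · rw [rightTrans_lin]; rfl
        · rw [rightTrans_linInv, inv_one]; rfl
      rw [this]; rfl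
    · intro g
      have : (rightTrans g⁻¹).comp (rightTrans g) = AlgHom.id K (CoordPoly K V) := by
        refine coordPoly_algHom_ext (fun φ => ?_) fun φ => ?_
        · rw [AlgHom.comp_apply, rightTrans_lin, rightTrans_lin]
          refine congrArg lin (LinearMap.ext fun a => ?_)
          simp only [LinearMap.comp_apply, LinearMap.mulRight_apply]
          rw [mul_assoc, Units.inv_mul, mul_one]
        · rw [AlgHom.comp_apply, rightTrans_linInv, rightTrans_linInv, inv_inv]
          refine congrArg linInv (LinearMap.ext fun a => ?_)
          simp only [LinearMap.comp_apply, LinearMap.mulLeft_apply]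
          rw [← mul_assoc, Units.inv_mul, one_mul]
      exact Function.LeftInverse.injective (g := rightTrans g⁻¹) fun f => AlgHom.congr_fun this f
    · rintro x hx f ⟨hf1, hf2⟩
      exact ⟨der_mem_affinePoly_pow x n f hf1, h hx f hf2⟩
  have h2 := mem_vanishing.1 h1.2 1 S.one_mem
  rwa [ev_rightTrans, one_mul] at h2

end Stable

/-! ### Cartan's criterion, Casimir elements and Weyl's theorem. -/

section CompleteReducibility

open Module LieAlgebra LieModule

attribute [local instance] LieRing.ofAssociativeRing

variable {K L M : Type*} [Field K] [LieRing L] [LieAlgebra K L]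
  [AddCommGroup M] [Module K M] [LieRingModule L M] [LieModule K L M]

theorem isNilpotent_ad_of_injective_toEnd (h : Function.Injective (toEnd K L M)) (x : L)
    (hx : IsNilpotent (toEnd K L M x)) : IsNilpotent (ad K L x) := by
  obtain ⟨n, hn⟩ := ad_nilpotent_of_nilpotent (R := K) hx
  refine ⟨n, LinearMap.ext fun y => h ?_⟩
  have key : ∀ k : ℕ, toEnd K L M ((ad K L x ^ k) y) =
      (ad K (End K M) (toEnd K L M x) ^ k) (toEnd K L M y) := by
    intro k
    induction k with
    | zero => simp
    | succ k ih =>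
      rw [pow_succ', pow_succ', Module.End.mul_apply, Module.End.mul_apply, ← ih, ad_apply, ad_apply,
        LieHom.map_lie]
  rw [key, hn]
  simp

variable [CharZero K] [FiniteDimensional K L] [FiniteDimensional K M]

/-- A Lie algebra with a faithful module of vanishing trace form is solvable. -/
theorem isSolvable_of_traceForm_eq_zero (h : Function.Injective (toEnd K L M))
    (htr : traceForm K L M = 0) : IsSolvable L := by
  let D : LieIdeal K L := derivedSeries K L 1
  -- The derived algebra acts nilpotently on M; by faithfulness it is ad-nilpotent, so Engel makes
  -- it nilpotent.
  have hD := isNilpotent_derivedSeries_of_traceForm_eq_zero htr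
  have hnil : LieRing.IsNilpotent D := by
    rw [LieAlgebra.isNilpotent_iff_forall (R := K)]
    intro x
    refine isNilpotent_ad_of_injective_toEnd (M := M) ?_ x
      ((LieModule.isNilpotent_iff_forall' (R := K)).mp hD x)
    intro y z hyz
    exact Subtype.ext (h hyz)
  obtain ⟨k, hk⟩ := IsSolvable.solvable K D
  rw [LieIdeal.derivedSeries_eq_bot_iff] at hk
  refine IsSolvable.mk (R := K) (k := k + 1) ?_
  rw [derivedSeries_def, derivedSeriesOfIdeal_add]
  exact hk

variable (K L M) in
/-- A Casimir element of a finite dimensional module `M` over a semisimple Lie algebra. -/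
theorem exists_casimir [HasTrivialRadical K L] : ∃ c : End K M,
    (∀ x : L, Commute (toEnd K L M x) c) ∧
    (∀ W : LieSubmodule K L M, (∀ (x : L) (m : M), ⁅x, m⁆ ∈ W) → ∀ m, c m ∈ W) ∧
    (IsNilpotent c → ∀ (x : L) (m : M), ⁅x, m⁆ = 0) := by
  -- The action factors through the Killing complement J of its kernel, which acts faithfully. The
  -- Casimir element is built from J, where the trace form is nondegenerate.
  let I : LieIdeal K L := LieModule.ker K L M
  let J : LieIdeal K L := I.killingCompl
  have hIJ : IsCompl I J := I.isCompl_killingCompl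
  let B := traceForm K L M
  have hBI : ∀ x, ∀ y ∈ I, B x y = 0 := by
    intro x y hy
    have : toEnd K L M y = 0 := (LieModule.mem_ker K L M _).1 hy |> fun h => by
      ext m; exact h m
    simp [B, traceForm_apply_apply, this]
  have hnondeg : ∀ x ∈ J, (∀ y ∈ J, B x y = 0) → x = 0 := by
    let N : LieIdeal K L := LieAlgebra.InvariantForm.orthogonal B
      (LieModule.traceForm_lieInvariant K L M) ⊤
    have hN : ∀ x, x ∈ N ↔ ∀ y, B y x = 0 := by
      intro x
      rw [LieAlgebra.InvariantForm.mem_orthogonal]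
      simp
    let P : LieIdeal K L := N ⊓ J
    have hP : P = ⊥ := by
      -- The part of J in the radical of the trace form is a solvable ideal by Cartan's criterion,
      -- hence zero.
      refine HasTrivialRadical.eq_bot_of_isSolvable P (hI := ?_)
      refine isSolvable_of_traceForm_eq_zero (K := K) (M := M) ?_ ?_
      · rw [injective_iff_map_eq_zero]
        intro x hx
        have hxI : (x : L) ∈ I := (LieModule.mem_ker K L M _).2 fun m =>
          LinearMap.congr_fun hx m
        have : (x : L) ∈ I ⊓ J := ⟨hxI, x.2.2⟩
        rw [hIJ.inf_eq_bot] at this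
        exact Subtype.ext this
      · ext x y
        exact (hN y).1 y.2.1 x
    intro x hx hxy
    have : x ∈ P := by
      refine ⟨(hN x).2 fun y => ?_, hx⟩
      have hy : y ∈ I ⊔ J := hIJ.sup_eq_top ▸ LieSubmodule.mem_top y
      obtain ⟨a, ha, b, hb, rfl⟩ := (LieSubmodule.mem_sup _ _ _).1 hy
      rw [traceForm_comm, map_add, hBI x a ha, hxy b hb, add_zero]
    rw [hP] at this
    exact this
  let BJ : LinearMap.BilinForm K J := B.restrict J.toSubmodule
  have hBJsymm : BJ.IsSymm := ⟨fun x y => traceForm_comm K L M _ _⟩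
  have hBJ : BJ.Nondegenerate := by
    refine hBJsymm.isRefl.nondegenerate_iff_separatingLeft.mpr fun x hx => ?_
    exact Subtype.ext (hnondeg x x.2 fun y hy => hx ⟨y, hy⟩)
  let b := finBasis K J
  let b' := BJ.dualBasis hBJ b
  have hb' : ∀ x : J, x = ∑ i, B x (b i) • b' i := by
    intro x
    conv_lhs => rw [← b'.sum_repr x]
    simp only [b', LinearMap.BilinForm.dualBasis_repr_apply]
    rfl
  have hb : ∀ x : J, x = ∑ i, B x (b' i) • b i := by
    intro x
    have h1 : BJ.dualBasis hBJ b' = b := LinearMap.BilinForm.dualBasis_dualBasis hBJ hBJsymm b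
    conv_lhs => rw [← b.sum_repr x, ← h1]
    simp only [LinearMap.BilinForm.dualBasis_repr_apply]
    rw [h1]
    rfl
  let T := toEnd K L M
  let c : End K M := ∑ i, T (b i) * T (b' i)
  refine ⟨c, fun z => ?_, fun W hW m => ?_, fun hc x m => ?_⟩
  · have h1 : ∀ i, T ⁅z, (b i : L)⁆ = ∑ j, B ⁅z, (b i : L)⁆ (b' j) • T (b j) := by
      intro i
      have h2 := congrArg (fun y : J => T y) (hb ⟨⁅z, (b i : L)⁆, J.lie_mem (b i).2⟩)
      simpa [map_sum] using h2
    have h2 : ∀ i, T ⁅z, (b' i : L)⁆ = ∑ j, B ⁅z, (b' i : L)⁆ (b j) • T (b' j) := by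
      intro i
      have h2 := congrArg (fun y : J => T y) (hb' ⟨⁅z, (b' i : L)⁆, J.lie_mem (b' i).2⟩)
      simpa [map_sum] using h2
    have h3 : T z * c - c * T z =
        ∑ i, (T ⁅z, (b i : L)⁆ * T (b' i) + T (b i) * T ⁅z, (b' i : L)⁆) := by
      simp only [c, Finset.mul_sum, Finset.sum_mul, ← Finset.sum_sub_distrib, T, LieHom.map_lie,
        Ring.lie_def]
      refine Finset.sum_congr rfl fun i _ => ?_
      noncomm_ring
    have h4 : T z * c - c * T z = 0 := by
      rw [h3, Finset.sum_add_distrib]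
      simp only [h1, h2, Finset.sum_mul, Finset.mul_sum, smul_mul_assoc, mul_smul_comm]
      rw [Finset.sum_comm, ← Finset.sum_add_distrib]
      refine Finset.sum_eq_zero fun i _ => ?_
      rw [← Finset.sum_add_distrib]
      refine Finset.sum_eq_zero fun j _ => ?_
      rw [← add_smul]
      have : B ⁅z, (b j : L)⁆ (b' i) + B ⁅z, (b' i : L)⁆ (b j) = 0 := by
        have h5 := traceForm_apply_lie_apply' K L M z (b j : L) (b' i : L)
        change B ⁅z, (b j : L)⁆ (b' i) = - B (b j : L) ⁅z, (b' i : L)⁆ at h5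
        have h6 : B ⁅z, (b' i : L)⁆ (b j) = B (b j : L) ⁅z, (b' i : L)⁆ := traceForm_comm K L M _ _
        rw [h5, h6, neg_add_cancel]
      rw [this, zero_smul]
    exact sub_eq_zero.1 h4
  · simp only [c, LinearMap.sum_apply]
    exact sum_mem fun i _ => hW _ _
  -- Each summand of c has trace 1 by duality, so c has trace dim J. If c is nilpotent this
  -- vanishes, and in characteristic zero J = 0, leaving only the kernel I.
  · have htr : LinearMap.trace K M c = (finrank K J : K) := by
      simp only [c, map_sum]
      have : ∀ i, LinearMap.trace K M (T (b i) * T (b' i)) = 1 := by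
        intro i
        have := LinearMap.BilinForm.apply_dualBasis_right hBJ hBJsymm b i i
        rw [if_pos rfl] at this
        exact this
      simp [this]
    have h0 : (finrank K J : K) = 0 := by
      rw [← htr]
      exact (LinearMap.isNilpotent_trace_of_isNilpotent hc).eq_zero
    have hJ : Subsingleton J := finrank_zero_iff.1 (by exact_mod_cast h0)
    have hx : x ∈ I ⊔ J := hIJ.sup_eq_top ▸ LieSubmodule.mem_top x
    obtain ⟨y, hy, z, hz, rfl⟩ := (LieSubmodule.mem_sup _ _ _).1 hx
    have hz0 : z = 0 := congrArg Subtype.val (Subsingleton.elim (⟨z, hz⟩ : J) 0)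
    rw [hz0, add_zero]
    exact (LieModule.mem_ker K L M _).1 hy m

/-- Whitehead's first lemma in module form: if `L` semisimple maps `M` into a proper submodule `W`,
there is an invariant vector outside `W`. -/
theorem exists_invariant_notMem [HasTrivialRadical K L] (W : LieSubmodule K L M)
    (hW : ∀ (x : L) (m : M), ⁅x, m⁆ ∈ W) (hW' : W ≠ ⊤) :
    ∃ v, v ∉ W ∧ ∀ x : L, ⁅x, v⁆ = 0 := by
  induction hn : finrank K M using Nat.strong_induction_on generalizing M with
  | _ n ih =>
  obtain ⟨c, hc, hcW, hcn⟩ := exists_casimir K L M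
  -- Fitting decomposition for c. Either c is nilpotent and L acts trivially, or the induction
  -- applies to ker cᵏ. That kernel is not inside W, because im cᵏ already is.
  obtain ⟨k, hk, hk1⟩ := ((LinearMap.eventually_isCompl_ker_pow_range_pow c).and
    (Filter.eventually_ge_atTop 1)).exists
  let M₀ : LieSubmodule K L M :=
    { LinearMap.ker (c ^ k) with
      lie_mem := fun {x m} hm => by
        have h1 : (c ^ k) m = 0 := hm
        have h2 := LinearMap.congr_fun ((hc x).pow_right k).eq m
        simp only [Module.End.mul_apply, h1, map_zero] at h2
        exact h2.symm }
  by_cases htop : M₀ = ⊤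
  · have hnil : IsNilpotent c := ⟨k, LinearMap.ext fun m => by
      have : m ∈ M₀ := htop ▸ LieSubmodule.mem_top m
      exact this⟩
    obtain ⟨v, hv⟩ := SetLike.exists_not_mem_of_ne_top W hW'
    exact ⟨v, hv, fun x => hcn hnil x v⟩
  · have hlt : finrank K M₀ < n := by
      rw [← hn]
      refine Submodule.finrank_lt (s := M₀.toSubmodule) fun h => htop ?_
      exact (LieSubmodule.toSubmodule_eq_top _).1 h
    obtain ⟨v, hv, hv'⟩ := ih _ hlt (M := M₀) (W.comap M₀.incl) (fun x m => hW x m) (by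
      intro h
      refine hW' ?_
      rw [eq_top_iff]
      intro m _
      obtain ⟨a, ha, d, ⟨e, rfl⟩, rfl⟩ := Submodule.mem_sup.1
        (hk.sup_eq_top ▸ Submodule.mem_top (x := m) :
          m ∈ LinearMap.ker (c ^ k) ⊔ LinearMap.range (c ^ k))
      refine add_mem ?_ ?_
      · have : (⟨a, ha⟩ : M₀) ∈ W.comap M₀.incl := h ▸ LieSubmodule.mem_top _
        exact this
      · obtain ⟨j, rfl⟩ := Nat.exists_eq_add_of_le' hk1
        rw [pow_succ', Module.End.mul_apply]
        exact hcW W hW _) rfl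
    exact ⟨v, hv, fun x => congrArg Subtype.val (hv' x)⟩

/-- **Weyl's theorem** on complete reducibility. -/
theorem exists_isCompl_lieSubmodule [HasTrivialRadical K L] (W : LieSubmodule K L M) :
    ∃ C : LieSubmodule K L M, IsCompl W.toSubmodule C.toSubmodule := by
  by_cases hbot : W = ⊥
  · exact ⟨⊤, by rw [hbot]; simpa using isCompl_bot_top⟩
  -- U consists of the maps acting on W as a scalar and U₀ of those vanishing on W. L maps U into
  -- U₀, and a linear retraction onto W lies outside U₀. An invariant element outside U₀ is an
  -- equivariant map, nonzero scalar on W, and its kernel is the complement.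
  let U : LieSubmodule K L (M →ₗ[K] W) :=
    { carrier := {f | ∃ a : K, ∀ w : W, f w = a • w}
      add_mem' := by
        rintro f g ⟨a, ha⟩ ⟨b, hb⟩
        exact ⟨a + b, fun w => by simp [ha, hb, add_smul]⟩
      zero_mem' := ⟨0, fun w => by simp⟩
      smul_mem' := by
        rintro t f ⟨a, ha⟩
        exact ⟨t * a, fun w => by simp [ha, mul_smul]⟩
      lie_mem := by
        rintro x f ⟨a, ha⟩
        refine ⟨0, fun w => ?_⟩
        have := ha ⁅x, w⁆
        simp only [LieSubmodule.coe_bracket] at this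
        simp [LieHom.lie_apply, ha, this] }
  let U₀ : LieSubmodule K L U :=
    { carrier := {f | ∀ w : W, (f : M →ₗ[K] W) w = 0}
      add_mem' := fun {f g} hf hg w => by
        have h1 := hf w
        have h2 := hg w
        simp [h1, h2]
      zero_mem' := fun w => by simp
      smul_mem' := fun t f hf w => by
        have h1 := hf w
        simp [h1]
      lie_mem := fun {x f} hf w => by
        have h1 := hf w
        have h2 := hf ⁅x, w⁆
        simp only [LieSubmodule.coe_bracket] at h2
        simp [LieHom.lie_apply, h1, h2] }
  obtain ⟨σ, hσ⟩ := LinearMap.exists_leftInverse_of_injective W.toSubmodule.subtype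
    (Submodule.ker_subtype _)
  have hσ' : ∀ w : W, σ w = w := fun w => LinearMap.congr_fun hσ w
  obtain ⟨⟨f, a, ha⟩, hf, hfx⟩ := exists_invariant_notMem (L := L) U₀
    (by
      rintro x ⟨f, a, ha⟩ w
      have := ha ⁅x, w⁆
      simp only [LieSubmodule.coe_bracket] at this
      simp [LieHom.lie_apply, ha, this])
    (by
      intro h
      obtain ⟨w, hw, hw0⟩ := (Submodule.ne_bot_iff _).1
        fun h => hbot ((LieSubmodule.toSubmodule_eq_bot W).1 h)
      have : (⟨σ, 1, fun w => by rw [hσ', one_smul]⟩ : U) ∈ U₀ := h ▸ LieSubmodule.mem_top _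
      have h1 := this ⟨w, hw⟩
      change σ w = 0 at h1
      rw [hσ' ⟨w, hw⟩] at h1
      exact hw0 (congrArg Subtype.val h1))
  have ha0 : a ≠ 0 := by
    rintro rfl
    exact hf fun w => by simpa using ha w
  have hfx' : ∀ (x : L) (m : M), f ⁅x, m⁆ = ⁅x, f m⁆ := by
    intro x m
    have h1 := congrArg Subtype.val (hfx x)
    have h2 := LinearMap.congr_fun h1 m
    simp only [LieSubmodule.coe_bracket, LieHom.lie_apply] at h2
    exact (sub_eq_zero.1 h2).symm
  refine ⟨{ LinearMap.ker f with
    lie_mem := fun {x m} hm => by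
      have h1 : f m = 0 := hm
      have h2 := hfx' x m
      rw [h1, lie_zero] at h2
      exact h2 }, ?_⟩
  rw [isCompl_iff, Submodule.disjoint_def, codisjoint_iff, eq_top_iff]
  refine ⟨fun m hm hm' => ?_, fun m _ => ?_⟩
  · have h1 : f m = 0 := hm'
    have h2 := ha ⟨m, hm⟩
    rw [h1] at h2
    exact congrArg Subtype.val ((smul_eq_zero.1 h2.symm).resolve_left ha0)
  · refine Submodule.mem_sup.2 ⟨(a⁻¹ • f m : W), (a⁻¹ • f m : W).2, m - (a⁻¹ • f m : W), ?_, by abel⟩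
    change f (m - ((a⁻¹ • f m : W) : M)) = 0
    rw [map_sub, ha, smul_smul, mul_inv_cancel₀ ha0, one_smul, sub_self]

end CompleteReducibility

/-! ### Determinants and traces on stable subspaces. -/

section Determinants

open MvPolynomial Module

attribute [local instance] zariskiTopology LieRing.ofAssociativeRing

variable {K : Type*} [Field K] {V : Type*} [AddCommGroup V] [Module K V] [FiniteDimensional K V]

/-- The subspaces stable under a set of automorphisms are stable under its Zariski closure. -/
theorem apply_mem_of_mem_closure {D : Set (LinearMap.GeneralLinearGroup K V)} {W : Submodule K V}
    (hW : ∀ g ∈ D, ∀ w ∈ W, (g : End K V) w ∈ W) {g : LinearMap.GeneralLinearGroup K V}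
    (hg : g ∈ closure D) {w : V} (hw : w ∈ W) : (g : End K V) w ∈ W := by
  by_contra hcon
  obtain ⟨ψ, hψ, hψ'⟩ := Submodule.exists_le_ker_of_notMem hcon
  refine hψ ?_
  have h1 := closure_minimal (t := {g : LinearMap.GeneralLinearGroup K V |
    ev g (lin (ψ ∘ₗ LinearMap.applyₗ w)) = 0}) (fun a ha => ?_) (isClosed_setOf_ev_eq_zero' _) hg
  · simpa using h1
  · simpa using hψ' (hW a ha w hw)

/-- Composing with a linear retraction onto W gives a polynomial defined for all g, which is the
determinant on W whenever g preserves W. -/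
theorem exists_ev_eq_det_restrict (W : Submodule K V) : ∃ q : CoordPoly K V,
    (∀ (g : LinearMap.GeneralLinearGroup K V) (hg : ∀ w ∈ W, (g : End K V) w ∈ W),
      ev g q = LinearMap.det ((g : End K V).restrict hg)) ∧
    ∀ (x : End K V) (hx : ∀ w ∈ W, x w ∈ W) (g : LinearMap.GeneralLinearGroup K V),
      ev g (der x q) = LinearMap.trace K W (x.restrict hx) * ev g q := by
  obtain ⟨σ, hσ⟩ := LinearMap.exists_leftInverse_of_injective W.subtype (Submodule.ker_subtype W)
  obtain ⟨q, hq, hq'⟩ := exists_ev_eq_det (fun g => (g : End K V)) (fun x => x)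
    (fun v ℓ => ⟨lin (ℓ ∘ₗ LinearMap.applyₗ v), fun g => by simp, fun x g => by simp⟩) W σ
  refine ⟨q, fun g hg => ?_, hq'⟩
  rw [hq]
  congr 1
  ext w : 1
  exact LinearMap.congr_fun hσ ((g : End K V).restrict hg w)

theorem trace_restrict_eq_zero_of_det_eq_one {S : Subgroup (LinearMap.GeneralLinearGroup K V)}
    {W : Submodule K V} (hW : ∀ g ∈ S, ∀ w ∈ W, (g : End K V) w ∈ W)
    (hdet : ∀ g (hg : g ∈ S), LinearMap.det ((g : End K V).restrict (hW g hg)) = 1)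
    {x : End K V} (hx : x ∈ lieAlg S) (hxW : ∀ w ∈ W, x w ∈ W) :
    LinearMap.trace K W (x.restrict hxW) = 0 := by
  obtain ⟨q, hq, hq'⟩ := exists_ev_eq_det_restrict W
  have h1 : q - 1 ∈ vanishing (S : Set (LinearMap.GeneralLinearGroup K V)) := by
    rw [mem_vanishing]
    intro g hg
    rw [map_sub, map_one, hq g (hW g hg), hdet g hg, sub_self]
  have h2 := mem_lieAlg_iff.1 hx _ h1
  rw [map_sub, Derivation.map_one_eq_zero, sub_zero, hq' x hxW, hq 1 (hW 1 S.one_mem),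
    hdet 1 S.one_mem, mul_one] at h2
  exact h2

/-- The determinant on W and the constant 1 both have zero logarithmic derivative along Lie S, so
they are proportional, and they agree at the identity. -/
theorem det_restrict_eq_one_of_trace_eq_zero [IsAlgClosed K] [CharZero K]
    {S : Subgroup (LinearMap.GeneralLinearGroup K V)}
    (hS : (vanishing (S : Set (LinearMap.GeneralLinearGroup K V))).IsPrime)
    {W : Submodule K V} (hW : ∀ x ∈ lieAlg S, ∀ w ∈ W, x w ∈ W)
    (htr : ∀ x (hx : x ∈ lieAlg S), LinearMap.trace K W (x.restrict (hW x hx)) = 0)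
    {g : LinearMap.GeneralLinearGroup K V} (hg : g ∈ S) (hgW : ∀ w ∈ W, (g : End K V) w ∈ W) :
    LinearMap.det ((g : End K V).restrict hgW) = 1 := by
  obtain ⟨q, hq, hq'⟩ := exists_ev_eq_det_restrict W
  have h1 : ev 1 q = 1 := by
    rw [hq 1 fun w hw => hw]
    exact LinearMap.det_id
  have h2 := ev_mul_ev_eq_of_forall_der hS q 1
    (fun x hx c _ => by rw [hq' x (hW x hx), htr x hx, Derivation.map_one_eq_zero]; simp) hg
  rw [h1, map_one, map_one, mul_one, one_mul, hq g hgW] at h2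
  exact h2

/-- The product of det - c over the possible values c vanishes on S. By primality one factor does,
and the value at the identity forces c = 1. -/
theorem det_restrict_eq_one_of_finite {S : Subgroup (LinearMap.GeneralLinearGroup K V)}
    (hS : (vanishing (S : Set (LinearMap.GeneralLinearGroup K V))).IsPrime)
    {D : Set (LinearMap.GeneralLinearGroup K V)}
    (hSD : (S : Set (LinearMap.GeneralLinearGroup K V)) ⊆ closure D)
    {W : Submodule K V} (hD : ∀ g ∈ D, ∀ w ∈ W, (g : End K V) w ∈ W) {T : Set K} (hT : T.Finite)
    (hDT : ∀ g (hg : g ∈ D), LinearMap.det ((g : End K V).restrict (hD g hg)) ∈ T)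
    {g : LinearMap.GeneralLinearGroup K V} (hg : g ∈ S) (hgW : ∀ w ∈ W, (g : End K V) w ∈ W) :
    LinearMap.det ((g : End K V).restrict hgW) = 1 := by
  obtain ⟨q, hq, -⟩ := exists_ev_eq_det_restrict W
  have h1 : ∏ c ∈ hT.toFinset, (q - C c) ∈
      vanishing (S : Set (LinearMap.GeneralLinearGroup K V)) := by
    rw [mem_vanishing]
    intro a ha
    refine closure_minimal (t := {g : LinearMap.GeneralLinearGroup K V |
      ev g (∏ c ∈ hT.toFinset, (q - C c)) = 0}) (fun a ha => ?_) (isClosed_setOf_ev_eq_zero' _)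
      (hSD ha)
    rw [Set.mem_ofPred_eq, map_prod]
    refine Finset.prod_eq_zero (hT.mem_toFinset.2 (hDT a ha)) ?_
    rw [map_sub, hq a (hD a ha), ← MvPolynomial.algebraMap_eq, AlgHom.commutes]
    exact sub_self _
  obtain ⟨c, -, hc⟩ := (Ideal.IsPrime.prod_mem_iff (hp := hS)).1 h1
  rw [mem_vanishing] at hc
  have h2 := hc 1 S.one_mem
  have h3 := hc g hg
  rw [map_sub, hq g hgW, sub_eq_zero] at h3
  rw [map_sub, hq 1 fun w hw => hw, sub_eq_zero] at h2
  rw [h3, ← MvPolynomial.algebraMap_eq, AlgHom.commutes]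
  rw [← MvPolynomial.algebraMap_eq, AlgHom.commutes] at h2
  rw [← h2]
  exact LinearMap.det_id

end Determinants

/-! ### Formal exponentials, and semisimplicity of the Lie algebra. -/

section SemisimpleLieAlgebra

open MvPolynomial Module

attribute [local instance] zariskiTopology LieRing.ofAssociativeRing

variable {K : Type*} [Field K] {V : Type*} [AddCommGroup V] [Module K V] [FiniteDimensional K V]

/-- Nullstellensatz for `GL(V)`. -/
theorem mem_of_forall_ev_eq_zero [IsAlgClosed K] {I : Ideal (CoordPoly K V)} (hI : I.IsPrime)
    (hle : vanishing (Set.univ : Set (LinearMap.GeneralLinearGroup K V)) ≤ I) {f : CoordPoly K V}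
    (hf : ∀ g : LinearMap.GeneralLinearGroup K V, (∀ p ∈ I, ev g p = 0) → ev g f = 0) : f ∈ I := by
  rw [← hI.radical, ← vanishingIdeal_zeroLocus_eq_radical (K := K)]
  intro z hz
  let χ : CoordPoly K V →ₐ[K] K := aeval z
  let A : End K V := ∑ i, z (Sum.inl i) • endBasis K V i
  let B : End K V := ∑ i, z (Sum.inr i) • endBasis K V i
  have hA : ∀ φ, χ (lin φ) = φ A := fun φ => by simp [χ, lin, A, mul_comm]
  have hB : ∀ φ, χ (linInv φ) = φ B := fun φ => by simp [χ, linInv, B, mul_comm]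
  -- The zero z is a priori only a pair of endomorphisms; the relations of GL(V), contained in I,
  -- make them inverse to each other.
  have hAB : A * B = 1 := by
    refine sub_eq_zero.1 ((Module.forall_dual_apply_eq_zero_iff K _).1 fun φ => ?_)
    have h1 : conjPoly 1 φ - C (φ 1) ∈
        vanishing (Set.univ : Set (LinearMap.GeneralLinearGroup K V)) := by
      rw [mem_vanishing]
      intro g _
      rw [map_sub, ev_conjPoly, ← MvPolynomial.algebraMap_eq, AlgHom.commutes]
      simp
    have h2 : χ (conjPoly 1 φ - C (φ 1)) = 0 := hz _ (hle h1)
    have h3 := sum_apply_coord φ A 1 B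
    rw [mul_one] at h3
    rw [map_sub, ← h3, ← h2, map_sub, ← MvPolynomial.algebraMap_eq, AlgHom.commutes]
    simp [conjPoly, hA, hB, -Basis.coord_apply]
  let g : LinearMap.GeneralLinearGroup K V := ⟨A, B, hAB, mul_eq_one_comm.1 hAB⟩
  have hχ : χ = ev g := by
    refine coordPoly_algHom_ext (fun φ => ?_) fun φ => ?_
    · rw [hA, ev_lin]
    · rw [hB, ev_linInv]; rfl
  change χ f = 0
  rw [hχ]
  refine hf g fun p hp => ?_
  rw [← hχ]
  exact hz p hp

/-- The coordinates of the formal one-parameter group `exp (t x)`. -/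
noncomputable def expSeries (x : End K V) : Dual K (End K V) →ₗ[K] PowerSeries K where
  toFun φ := PowerSeries.mk fun n => φ (x ^ n) / n.factorial
  map_add' φ ψ := by ext n; simp [add_div]
  map_smul' c φ := by ext n; simp [mul_div_assoc]

/-- Evaluation at the formal one-parameter group `exp (t x)`. -/
noncomputable def evExp (x : End K V) : CoordPoly K V →ₐ[K] PowerSeries K :=
  coordLift (expSeries x) (expSeries (-x))

theorem coeff_zero_evExp (x : End K V) (f : CoordPoly K V) :
    PowerSeries.coeff 0 (evExp x f) = ev 1 f := by
  rw [PowerSeries.coeff_zero_eq_constantCoeff_apply]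
  induction f using coordPoly_induction with
  | hC c => simp [← MvPolynomial.algebraMap_eq]
  | hadd f g hf hg => simp [hf, hg]
  | hmul f g hf hg => simp [hf, hg]
  | hlin φ =>
    rw [← PowerSeries.coeff_zero_eq_constantCoeff_apply]
    simp [evExp, expSeries]
  | hlinInv φ =>
    rw [← PowerSeries.coeff_zero_eq_constantCoeff_apply]
    simp [evExp, expSeries]

/-- The curve exp(tx) is an integral curve of the invariant field of x. -/
theorem derivative_evExp [CharZero K] (x : End K V) (f : CoordPoly K V) :
    PowerSeries.derivative K (evExp x f) = evExp x (der x f) := by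
  have hfac : ∀ (n : ℕ) (c : K), c / ((n + 1).factorial : K) * (n + 1) = c / n.factorial := by
    intro n c
    have h1 : (n.factorial : K) ≠ 0 := Nat.cast_ne_zero.2 n.factorial_ne_zero
    have h2 : (n + 1 : K) ≠ 0 := Nat.cast_add_one_ne_zero n
    rw [Nat.factorial_succ]
    push_cast
    field_simp
  induction f using coordPoly_induction with
  | hC c => simp [← MvPolynomial.algebraMap_eq]
  | hadd f g hf hg => simp [hf, hg]
  | hmul f g hf hg => simp [hf, hg]
  | hlin φ =>
    ext n
    rw [PowerSeries.coeff_derivative, der_lin]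
    simp [evExp, expSeries, hfac, pow_succ]
  | hlinInv φ =>
    ext n
    rw [PowerSeries.coeff_derivative, der_linInv, map_neg]
    simp only [evExp, coordLift_linInv, expSeries, LinearMap.coe_mk, AddHom.coe_mk,
      PowerSeries.coeff_mk, hfac, map_neg, LinearMap.comp_apply, LinearMap.mulLeft_apply]
    rw [pow_succ', neg_mul, map_neg, neg_div]

/-- The formal curve exp(tx) stays in S: up to factorials, its Taylor coefficients are values at 1
of iterated derivatives of f, all of which vanish on S. -/
theorem evExp_eq_zero [CharZero K] {S : Subgroup (LinearMap.GeneralLinearGroup K V)} {x : End K V}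
    (hx : x ∈ lieAlg S) {f : CoordPoly K V}
    (hf : f ∈ vanishing (S : Set (LinearMap.GeneralLinearGroup K V))) : evExp x f = 0 := by
  ext n
  rw [map_zero]
  induction n generalizing f with
  | zero => rw [coeff_zero_evExp]; exact mem_vanishing.1 hf 1 S.one_mem
  | succ n ih =>
    have h1 := PowerSeries.coeff_derivative (evExp x f) n
    rw [derivative_evExp, ih (hx f hf)] at h1
    exact (mul_eq_zero.1 h1.symm).resolve_right (Nat.cast_add_one_ne_zero n)

theorem ev_der_eq_zero_of_evExp_eq_zero [CharZero K] {x : End K V} {f : CoordPoly K V}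
    (hf : evExp x f = 0) : ev 1 (der x f) = 0 := by
  rw [← coeff_zero_evExp x, ← derivative_evExp, hf]
  simp

/-- The Lie algebra of the group of those `s ∈ S` that commute with the elements of `T` contains the
elements of `Lie S` that commute with `T`. -/
theorem mem_lieAlg_of_commute [IsAlgClosed K] [CharZero K]
    {S Z : Subgroup (LinearMap.GeneralLinearGroup K V)}
    (hS : IsClosed (S : Set (LinearMap.GeneralLinearGroup K V))) {T : Set (End K V)}
    (hZ : ∀ s ∈ S, (∀ t ∈ T, Commute (s : End K V) t) → s ∈ Z) {x : End K V}
    (hx : x ∈ lieAlg S) (hxT : ∀ t ∈ T, Commute x t) : x ∈ lieAlg Z := by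
  rw [mem_lieAlg_iff]
  intro f hf
  refine ev_der_eq_zero_of_evExp_eq_zero ?_
  rw [← RingHom.mem_ker]
  -- The zero locus of the prime kernel plays the role of the closure of exp(tx). Its points lie in
  -- S and commute with T, hence lie in Z where f vanishes, and the Nullstellensatz gives that f is
  -- zero along exp(tx).
  refine mem_of_forall_ev_eq_zero (RingHom.ker_isPrime _) (fun p hp => ?_) fun g hg => ?_
  · exact evExp_eq_zero hx (mem_vanishing.2 fun g _ => mem_vanishing.1 hp g (Set.mem_univ _))
  · refine mem_vanishing.1 hf g (hZ g (mem_of_isClosed hS fun p hp => ?_) fun t ht => ?_)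
    · exact hg p (evExp_eq_zero hx hp)
    · refine sub_eq_zero.1 ((Module.forall_dual_apply_eq_zero_iff K _).1 fun φ => ?_)
      have h1 := hg (lin (φ ∘ₗ (LinearMap.mulRight K t - LinearMap.mulLeft K t))) (by
        rw [RingHom.mem_ker]
        ext n
        have h2 : x ^ n * t = t * x ^ n := (hxT t ht).pow_left n
        simp [evExp, expSeries, h2])
      simpa using h1

theorem isClosed_setOf_commute (t : End K V) :
    IsClosed {g : LinearMap.GeneralLinearGroup K V | Commute (g : End K V) t} := by
  have : {g : LinearMap.GeneralLinearGroup K V | Commute (g : End K V) t} =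
      {g | ∀ f ∈ Set.range fun φ : Dual K (End K V) =>
        lin (φ ∘ₗ (LinearMap.mulRight K t - LinearMap.mulLeft K t)), ev g f = 0} := by
    ext g
    simp only [Set.forall_mem_range, Set.mem_ofPred_eq, ev_lin]
    rw [commute_iff_eq, ← sub_eq_zero, ← Module.forall_dual_apply_eq_zero_iff K]
    rfl
  rw [this]
  exact isClosed_setOf_ev_eq_zero _

/-- The Lie algebra of a semisimple algebraic group is semisimple. -/
theorem hasTrivialRadical_lieAlg [IsAlgClosed K] [CharZero K]
    {S : Subgroup (LinearMap.GeneralLinearGroup K V)} (hconn : IsZariskiConnected S)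
    (hcl : IsClosed (S : Set (LinearMap.GeneralLinearGroup K V))) (hss : IsSemisimpleAlgGroup S) :
    LieAlgebra.HasTrivialRadical K (lieAlg S) := by
  rw [LieAlgebra.hasTrivialRadical_iff_no_abelian_ideals]
  intro I hI
  let W : Submodule K (End K V) := I.toSubmodule.map (lieAlg S).toSubmodule.subtype
  have hWS : ∀ w ∈ W, w ∈ lieAlg S := by
    rintro _ ⟨y, -, rfl⟩
    exact y.2
  have hWcomm : ∀ w ∈ W, ∀ w' ∈ W, Commute w w' := by
    rintro _ ⟨y, hy, rfl⟩ _ ⟨y', hy', rfl⟩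
    have h1 : ⁅(⟨y, hy⟩ : I), (⟨y', hy'⟩ : I)⁆ = 0 := hI.trivial _ _
    have h2 : ⁅(y : End K V), (y' : End K V)⁆ = 0 :=
      congrArg (fun z : I => ((z : lieAlg S) : End K V)) h1
    exact sub_eq_zero.1 h2
  have hconj : ∀ g ∈ S, ∀ w ∈ W,
      (g : End K V) * w * ((g⁻¹ : LinearMap.GeneralLinearGroup K V) : End K V) ∈ W := by
    refine fun g hg w hw => conj_mem_of_lieAlg_stable (isPrime_vanishing hconn) ?_ hg hw
    rintro x hx _ ⟨y, hy, rfl⟩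
    exact ⟨⁅(⟨x, hx⟩ : lieAlg S), y⁆, I.lie_mem hy, rfl⟩
  have hcomm_conj : ∀ (m c : LinearMap.GeneralLinearGroup K V), m ∈ S →
      (∀ w ∈ W, Commute (c : End K V) w) →
        ∀ w ∈ W, Commute ((m * c * m⁻¹ : LinearMap.GeneralLinearGroup K V) : End K V) w := by
    intro m c hm hc w hw
    have h1 := (hc _ (hconj m⁻¹ (S.inv_mem hm) w hw)).eq
    rw [inv_inv] at h1
    have h2 := congrArg (fun z : End K V => (m : End K V) * z *
      ((m⁻¹ : LinearMap.GeneralLinearGroup K V) : End K V)) h1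
    simp only [← mul_assoc, Units.mul_inv, one_mul] at h2
    simp only [mul_assoc, Units.mul_inv, mul_one] at h2
    rw [commute_iff_eq]
    simpa only [Units.val_mul, mul_assoc] using h2
  -- T is the abelian ideal W together with its centralizer in S, so the group Z below is the center
  -- of that centralizer. It is commutative, and normal in S because conjugation by S preserves W.
  let T : Set (End K V) := W ∪ {t | ∃ c ∈ S, (∀ w ∈ W, Commute (c : End K V) w) ∧ c = t}
  let Z : Subgroup (LinearMap.GeneralLinearGroup K V) :=
    { carrier := {s | s ∈ S ∧ ∀ t ∈ T, Commute (s : End K V) t}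
      one_mem' := ⟨S.one_mem, fun t _ => Commute.one_left t⟩
      mul_mem' := fun {a b} ha hb => ⟨S.mul_mem ha.1 hb.1, fun t ht => by
        rw [Units.val_mul]; exact (ha.2 t ht).mul_left (hb.2 t ht)⟩
      inv_mem' := fun {a} ha => ⟨S.inv_mem ha.1, fun t ht => (ha.2 t ht).units_inv_left⟩ }
  have hZS : Z ≤ S := fun z hz => hz.1
  have hZcl : IsClosed (Z : Set (LinearMap.GeneralLinearGroup K V)) := by
    have : (Z : Set (LinearMap.GeneralLinearGroup K V)) =
        (S : Set (LinearMap.GeneralLinearGroup K V)) ∩ ⋂ t ∈ T, {g | Commute (g : End K V) t} := by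
      ext g
      simp only [Set.mem_inter_iff, Set.mem_iInter]
      rfl
    rw [this]
    exact hcl.inter (isClosed_biInter fun t _ => isClosed_setOf_commute t)
  have hZcomm : ∀ a ∈ Z, ∀ b ∈ Z, a * b = b * a := fun a ha b hb => by
    refine Units.ext ?_
    exact ha.2 b (Or.inr ⟨b, hb.1, fun w hw => hb.2 w (Or.inl hw), rfl⟩)
  have hZnorm : ∀ m ∈ S, ∀ z ∈ Z, m * z * m⁻¹ ∈ Z := by
    intro m hm z hz
    refine ⟨S.mul_mem (S.mul_mem hm hz.1) (S.inv_mem hm), ?_⟩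
    rintro t (ht | ⟨c, hc, hcW, rfl⟩)
    · exact hcomm_conj m z hm (fun w hw => hz.2 w (Or.inl hw)) t ht
    · have h1 : Commute z (m⁻¹ * c * m⁻¹⁻¹) := by
        refine Units.ext ?_
        exact hz.2 _ (Or.inr ⟨m⁻¹ * c * m⁻¹⁻¹,
          S.mul_mem (S.mul_mem (S.inv_mem hm) hc) (S.inv_mem (S.inv_mem hm)),
          hcomm_conj m⁻¹ c (S.inv_mem hm) hcW, rfl⟩)
      have h2 : m * z * m⁻¹ * c = c * (m * z * m⁻¹) := by
        have h3 := congrArg (fun y => m * y * m⁻¹) h1.eq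
        simpa [mul_assoc] using h3
      exact congrArg Units.val h2
  have hZ₀ : identityComponent Z = ⊥ := by
    refine hss _ ((identityComponent_le Z).trans hZS) (fun m hm z hz => ?_)
      ((isClosed_iff _).1 (isClosed_identityComponent hZcl))
      (isZariskiConnected_identityComponent Z) ?_
    · refine IsPreconnected.subset_connectedComponentIn
        ((isZariskiConnected_identityComponent Z).2.image _ (continuous_conj m).continuousOn)
        ⟨1, (identityComponent Z).one_mem, by simp⟩ ?_ ⟨z, hz, rfl⟩
      rintro _ ⟨y, hy, rfl⟩
      exact hZnorm m hm y (identityComponent_le Z hy)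
    · refine Group.isSolvable_of_comm fun a b => Subtype.ext ?_
      exact hZcomm a (identityComponent_le Z a.2) b (identityComponent_le Z b.2)
  -- With trivial identity component of finite index, Z is finite and has no Lie algebra. Yet W
  -- commutes with T, so it lies in Lie Z.
  have hZfin : (Z : Set (LinearMap.GeneralLinearGroup K V)).Finite := by
    have h1 := finiteIndex_identityComponent Z
    rw [hZ₀, Subgroup.bot_subgroupOf] at h1
    have h2 : Finite Z := Nat.finite_of_card_ne_zero (Subgroup.index_bot (G := Z) ▸ h1.index_ne_zero)
    exact Set.toFinite _
  rw [eq_bot_iff]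
  intro y hy
  have hyW : (y : End K V) ∈ W := ⟨y, hy, rfl⟩
  have h1 : (y : End K V) ∈ lieAlg Z := by
    refine mem_lieAlg_of_commute hcl (T := T) (fun s hs hsT => (⟨hs, hsT⟩ : s ∈ S ∧ _)) y.2 ?_
    rintro t (ht | ⟨c, hc, hcW, rfl⟩)
    · exact hWcomm _ hyW t ht
    · exact (hcW _ hyW).symm
  exact Subtype.ext (lieAlg_eq_bot_of_finite hZfin h1)

end SemisimpleLieAlgebra

/-! ### Perfectness, inner derivations and Schur's lemma. -/

section SemisimpleLieAlgebraActions

open MvPolynomial Module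

attribute [local instance] zariskiTopology LieRing.ofAssociativeRing

/-- A semisimple Lie algebra is perfect. -/
theorem eq_zero_of_forall_lie_eq_zero {K L : Type*} [Field K] [CharZero K] [LieRing L]
    [LieAlgebra K L] [FiniteDimensional K L] [LieAlgebra.HasTrivialRadical K L] (χ : L →ₗ[K] K)
    (hχ : ∀ x y : L, χ ⁅x, y⁆ = 0) : χ = 0 := by
  let B := killingForm K L
  have hB : B.Nondegenerate := LieAlgebra.IsKilling.killingForm_nondegenerate K L
  -- The Killing form represents χ by an element z. Invariance of the form puts z in the center,
  -- which is zero.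
  obtain ⟨z, hz⟩ := (LinearMap.BilinForm.toDual B hB).surjective χ
  have hz' : ∀ x, B z x = χ x := fun x => by
    rw [← hz, LinearMap.BilinForm.toDual_def]
  have hzc : z ∈ LieAlgebra.center K L := by
    rw [LieModule.mem_maxTrivSubmodule]
    intro x
    rw [← lie_skew, neg_eq_zero]
    refine hB.1 _ fun y => ?_
    have h1 := LieModule.traceForm_apply_lie_apply K L L z x y
    change B ⁅z, x⁆ y = B z ⁅x, y⁆ at h1
    rw [h1, hz', hχ]
  rw [LieAlgebra.center_eq_bot] at hzc
  ext x
  rw [← hz', (LieSubmodule.mem_bot z).1 hzc]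
  simp

variable {K : Type*} [Field K] {V : Type*} [AddCommGroup V] [Module K V] [FiniteDimensional K V]

theorem trace_restrict_eq_zero_of_hasTrivialRadical [CharZero K] (L : LieSubalgebra K (End K V))
    [LieAlgebra.HasTrivialRadical K L] {W : Submodule K V} (hW : ∀ x ∈ L, ∀ w ∈ W, x w ∈ W)
    {x : End K V} (hx : x ∈ L) (hxW : ∀ w ∈ W, x w ∈ W) :
    LinearMap.trace K W (x.restrict hxW) = 0 := by
  let r : L →ₗ[K] End K W :=
    { toFun := fun y => (y : End K V).restrict (hW y y.2)
      map_add' := fun y z => rfl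
      map_smul' := fun c y => rfl }
  have h1 := eq_zero_of_forall_lie_eq_zero (LinearMap.trace K W ∘ₗ r) fun y z => by
    have h2 : r ⁅y, z⁆ = r y * r z - r z * r y := rfl
    rw [LinearMap.comp_apply, h2, map_sub, LinearMap.trace_mul_comm, sub_self]
  exact LinearMap.congr_fun h1 ⟨x, hx⟩

/-- Let `M` be a group normalizing a semisimple group `S ⊆ M`. If `V` is generated by subspaces which
are stable under `M` with trivial determinant and irreducible under `S`, then `M` and `S` have
the same Lie algebra. -/
theorem lieAlg_le_of_isSemisimpleAlgGroup [IsAlgClosed K] [CharZero K]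
    {S M : Subgroup (LinearMap.GeneralLinearGroup K V)} (hconn : IsZariskiConnected S)
    (hcl : IsClosed (S : Set (LinearMap.GeneralLinearGroup K V))) (hss : IsSemisimpleAlgGroup S)
    (hSM : S ≤ M) (hMS : ∀ m ∈ M, ∀ s ∈ S, m * s * m⁻¹ ∈ S) (F : Set (Submodule K V))
    (hF : sSup F = ⊤) (hbot : ∀ W ∈ F, W ≠ ⊥)
    (hstab : ∀ W ∈ F, ∀ g ∈ M, ∀ w ∈ W, (g : End K V) w ∈ W)
    (hdet : ∀ W (hW : W ∈ F) g (hg : g ∈ M),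
      LinearMap.det ((g : End K V).restrict (hstab W hW g hg)) = 1)
    (hirr : ∀ W ∈ F, ∀ U ≤ W, (∀ g ∈ S, ∀ u ∈ U, (g : End K V) u ∈ U) → U = ⊥ ∨ U = W) :
    lieAlg M ≤ lieAlg S := by
  have hrad := hasTrivialRadical_lieAlg hconn hcl hss
  intro x hx
  let D : LieDerivation K (lieAlg S) (lieAlg S) :=
    { toFun := fun y => ⟨x * y - y * x, commutator_mem_lieAlg hMS hx y.2⟩
      map_add' := fun y z => Subtype.ext (by
        change x * ((y : End K V) + z) - (y + z) * x = (x * y - y * x) + (x * z - z * x)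
        noncomm_ring)
      map_smul' := fun c y => Subtype.ext (by
        change x * (c • (y : End K V)) - (c • (y : End K V)) * x = c • (x * y - y * x)
        rw [mul_smul_comm, smul_mul_assoc, smul_sub])
      leibniz' := fun y z => Subtype.ext (by
        change x * ((y : End K V) * z - z * y) - (y * z - z * y) * x =
          (y * (x * z - z * x) - (x * z - z * x) * y) - (z * (x * y - y * x) - (x * y - y * x) * z)
        noncomm_ring) }
  -- Derivations of a semisimple Lie algebra are inner, so x differs from y in Lie S by an element z
  -- commuting with Lie S.
  obtain ⟨y, hy⟩ := LieDerivation.IsKilling.exists_eq_ad D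
  let z : End K V := x - y
  have hz : ∀ l ∈ lieAlg S, z * l = l * z := by
    intro l hl
    have h1 : ⁅y, (⟨l, hl⟩ : lieAlg S)⁆ = D ⟨l, hl⟩ := by
      rw [← hy, LieDerivation.ad_apply_apply]
    have h2 : (y : End K V) * l - l * y = x * l - l * x := congrArg Subtype.val h1
    simp only [z, sub_mul, mul_sub]
    rw [sub_eq_sub_iff_sub_eq_sub, ← h2]
  have hzW : ∀ W ∈ F, W ≤ LinearMap.ker z := by
    intro W hW
    have hxW : ∀ w ∈ W, x w ∈ W := fun w hw => lieAlg_apply_mem_of_stable (hstab W hW) hx hw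
    have hSW : ∀ l ∈ lieAlg S, ∀ w ∈ W, l w ∈ W := fun l hl w hw =>
      lieAlg_apply_mem_of_stable (hstab W hW) (lieAlg_mono hSM hl) hw
    have hzW : ∀ w ∈ W, z w ∈ W := fun w hw => sub_mem (hxW w hw) (hSW y y.2 w hw)
    have hWn : Nontrivial W := Submodule.nontrivial_iff_ne_bot.2 (hbot W hW)
    obtain ⟨c, hc⟩ := Module.End.exists_eigenvalue (z.restrict hzW)
    -- Schur's lemma: the eigenspace of z in W is stable under Lie S, hence under S, so it is all of
    -- W.
    have hU : W ⊓ LinearMap.ker (z - algebraMap K (End K V) c) = W := by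
      refine (hirr W hW _ inf_le_left fun g hg u hu => ?_).resolve_left fun h => ?_
      · refine apply_mem_of_lieAlg_stable (isPrime_vanishing hconn) (fun l hl w hw => ?_) hg hu
        refine ⟨hSW l hl w hw.1, ?_⟩
        have h1 : z w - c • w = 0 := hw.2
        have h2 : z (l w) = l (z w) := LinearMap.congr_fun (hz l hl) w
        change z (l w) - c • l w = 0
        rw [h2, ← map_smul, ← map_sub, h1, map_zero]
      · obtain ⟨v, hv⟩ := hc.exists_hasEigenvector
        have h1 : (v : V) ∈ W ⊓ LinearMap.ker (z - algebraMap K (End K V) c) := by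
          refine ⟨v.2, ?_⟩
          change z v - c • (v : V) = 0
          exact sub_eq_zero.2 (congrArg Subtype.val hv.apply_eq_smul)
        rw [h] at h1
        exact hv.2 (Subtype.ext h1)
    have hzc : z.restrict hzW = c • LinearMap.id := by
      ext w
      have h1 : (w : V) ∈ W ⊓ LinearMap.ker (z - algebraMap K (End K V) c) := hU.symm ▸ w.2
      exact sub_eq_zero.1 h1.2
    have htr : LinearMap.trace K W (z.restrict hzW) = 0 := by
      have h1 : z.restrict hzW = x.restrict hxW - (y : End K V).restrict (hSW y y.2) := rfl
      rw [h1, map_sub, trace_restrict_eq_zero_of_det_eq_one (hstab W hW) (hdet W hW) hx hxW,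
        trace_restrict_eq_zero_of_hasTrivialRadical (lieAlg S) hSW y.2, sub_zero]
    rw [hzc, map_smul, LinearMap.trace_id, smul_eq_mul] at htr
    have hc0 : c = 0 := (mul_eq_zero.1 htr).resolve_right
      (Nat.cast_ne_zero.2 Module.finrank_pos.ne')
    intro w hw
    have h1 := congrArg Subtype.val (LinearMap.congr_fun hzc ⟨w, hw⟩)
    rw [hc0, zero_smul] at h1
    exact h1
  have hz0 : z = 0 := by
    rw [← LinearMap.ker_eq_top, eq_top_iff, ← hF]
    exact sSup_le hzW
  have hxy : x = y := sub_eq_zero.1 hz0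
  rw [hxy]
  exact y.2

end SemisimpleLieAlgebraActions

/-! ### Irreducible and semisimple representations through stable subspaces. -/

section Representations

variable {K : Type*} [Field K] {V : Type*} [AddCommGroup V] [Module K V]
  {G : Type*} [Group G]

/-- An arbitrary homomorphism f covers both the representation itself and its restriction to a
subgroup, with subspaces of V in place of subspaces of W. -/
theorem isIrreducible_comp_iff {H : Type*} [Group H] {ρ : Representation K G V} (f : H →* G)
    (W : Subrepresentation ρ) : Representation.IsIrreducible (W.toRepresentation.comp f) ↔
      W.toSubmodule ≠ ⊥ ∧ ∀ U ≤ W.toSubmodule, (∀ h, ∀ u ∈ U, ρ (f h) u ∈ U) →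
        U = ⊥ ∨ U = W.toSubmodule := by
  constructor
  · intro hirr
    refine ⟨fun hW => ?_, fun U hU hUst => ?_⟩
    · refine bot_ne_top (α := Subrepresentation (W.toRepresentation.comp f))
        (Subrepresentation.toSubmodule_injective ?_)
      have : Subsingleton W.toSubmodule := by rw [hW]; infer_instance
      exact Subsingleton.elim _ _
    · let U' : Subrepresentation (W.toRepresentation.comp f) :=
        ⟨U.comap W.toSubmodule.subtype, fun h u hu => hUst h u hu⟩
      rcases eq_bot_or_eq_top U' with h | h
      · refine Or.inl ((Submodule.eq_bot_iff _).2 fun u hu => ?_)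
        have h1 : (⟨u, hU hu⟩ : W.toSubmodule) ∈ U'.toSubmodule := hu
        rw [h] at h1
        exact congrArg Subtype.val ((Submodule.mem_bot K).1 h1)
      · refine Or.inr (le_antisymm hU fun w hw => ?_)
        have h1 : (⟨w, hw⟩ : W.toSubmodule) ∈ U'.toSubmodule := h ▸ Submodule.mem_top
        exact h1
  · rintro ⟨hW, hU⟩
    refine { exists_pair_ne := ⟨⊥, ⊤, fun h => hW ?_⟩, eq_bot_or_eq_top := fun σ => ?_ }
    · have h1 := congrArg Subrepresentation.toSubmodule h
      refine (Submodule.eq_bot_iff _).2 fun w hw => ?_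
      have h2 : (⟨w, hw⟩ : W.toSubmodule) ∈
        (⊥ : Subrepresentation (W.toRepresentation.comp f)).toSubmodule := h1 ▸ Submodule.mem_top
      exact congrArg Subtype.val ((Submodule.mem_bot K).1 h2)
    · rcases hU (σ.toSubmodule.map W.toSubmodule.subtype) (Submodule.map_subtype_le _ _) (by
        rintro h _ ⟨u, hu, rfl⟩
        exact ⟨_, σ.apply_mem_toSubmodule h hu, rfl⟩) with h | h
      · refine Or.inl (Subrepresentation.toSubmodule_injective ?_)
        exact (Submodule.map_injective_of_injective W.toSubmodule.injective_subtype)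
          (h.trans (Submodule.map_bot _).symm)
      · refine Or.inr (Subrepresentation.toSubmodule_injective ?_)
        refine eq_top_iff.2 fun w _ => ?_
        have h1 : (w : V) ∈ σ.toSubmodule.map W.toSubmodule.subtype := h.symm ▸ w.2
        obtain ⟨u, hu, huw⟩ := h1
        rwa [← Subtype.ext huw]

theorem isIrreducible_iff {ρ : Representation K G V} (W : Subrepresentation ρ) :
    Representation.IsIrreducible W.toRepresentation ↔
      W.toSubmodule ≠ ⊥ ∧ ∀ U ≤ W.toSubmodule, (∀ h, ∀ u ∈ U, ρ h u ∈ U) →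
        U = ⊥ ∨ U = W.toSubmodule :=
  isIrreducible_comp_iff (MonoidHom.id G) W

variable [FiniteDimensional K V]

/-- A semisimple representation is the sum of its irreducible subrepresentations. -/
theorem sSup_isIrreducible_eq_top {ρ : Representation K G V} (hρ : ρ.IsSemisimpleRepresentation) :
    sSup {U : Submodule K V | ∃ W : Subrepresentation ρ,
      Representation.IsIrreducible W.toRepresentation ∧ W.toSubmodule = U} = ⊤ := by
  set F := {U : Submodule K V | ∃ W : Subrepresentation ρ,
      Representation.IsIrreducible W.toRepresentation ∧ W.toSubmodule = U}
  let T : Subrepresentation ρ := ⟨sSup F, fun g v hv => by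
    have h1 : sSup F ≤ (sSup F).comap (ρ g) := by
      refine sSup_le ?_
      rintro _ ⟨W, hW, rfl⟩ w hw
      exact le_sSup (show W.toSubmodule ∈ F from ⟨W, hW, rfl⟩) (W.apply_mem_toSubmodule g hw)
    exact h1 hv⟩
  obtain ⟨C, hC⟩ := exists_isCompl T
  have hinf : sSup F ⊓ C.toSubmodule = ⊥ :=
    congrArg Subrepresentation.toSubmodule hC.inf_eq_bot
  have hsup : sSup F ⊔ C.toSubmodule = ⊤ :=
    congrArg Subrepresentation.toSubmodule hC.sup_eq_top
  by_contra hne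
  have hC0 : C.toSubmodule ≠ ⊥ := fun h => hne (by rw [← hsup, h, sup_bot_eq])
  -- A minimal nonzero stable subspace of the complement C is irreducible, so it lies in the sum as
  -- well as in C.
  obtain ⟨U, ⟨hU0, hUC, hUst⟩, hmin⟩ := wellFounded_lt.has_min
    {U : Submodule K V | U ≠ ⊥ ∧ U ≤ C.toSubmodule ∧ ∀ g, ∀ u ∈ U, ρ g u ∈ U}
    ⟨C.toSubmodule, hC0, le_rfl, fun g u hu => C.apply_mem_toSubmodule g hu⟩
  have hUF : U ∈ F := by
    refine ⟨⟨U, fun g u hu => hUst g u hu⟩, (isIrreducible_iff _).2 ⟨hU0, fun U' hU' hst => ?_⟩, rfl⟩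
    by_contra! h
    exact hmin U' ⟨h.1, hU'.trans hUC, hst⟩ (lt_of_le_of_ne hU' h.2)
  refine hU0 (eq_bot_iff.2 ?_)
  rw [← hinf]
  exact le_inf (le_sSup hUF) hUC

end Representations

/-! ### Monodromy groups and the two implications. -/

section Monodromy

open Module

attribute [local instance] zariskiTopology LieRing.ofAssociativeRing

variable {K : Type*} [Field K] {V : Type*} [AddCommGroup V] [Module K V]
  {G : Type*} [Group G] (ρ : Representation K G V)

theorem asGroupHom_mem_Mo (g : G) : ρ.asGroupHom g ∈ Mo ρ :=
  le_zariskiClosure _ ⟨g, rfl⟩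

theorem asGroupHom_mem_Mo_res {H : Subgroup G} {h : G} (hh : h ∈ H) :
    ρ.asGroupHom h ∈ Mo (res ρ H) :=
  le_zariskiClosure _ ⟨⟨h, hh⟩, Units.ext rfl⟩

theorem isClosed_Mo : IsClosed (Mo ρ : Set (LinearMap.GeneralLinearGroup K V)) :=
  isClosed_zariskiClosure _

theorem Mo_le {S : Subgroup (LinearMap.GeneralLinearGroup K V)}
    (hS : IsClosed (S : Set (LinearMap.GeneralLinearGroup K V))) (h : ∀ g, ρ.asGroupHom g ∈ S) :
    Mo ρ ≤ S := by
  refine zariskiClosure_le ?_ hS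
  rintro _ ⟨g, rfl⟩
  exact h g

theorem Mo_res_le (H : Subgroup G) : Mo (res ρ H) ≤ Mo ρ := by
  refine Mo_le _ (isClosed_Mo ρ) fun h => ?_
  have : (res ρ H).asGroupHom h = ρ.asGroupHom h := Units.ext rfl
  rw [this]
  exact asGroupHom_mem_Mo ρ h

/-- `Mo ρ` is covered by finitely many closed cosets of P = `Mo (res ρ G')`. Those different from P
form a closed set Q disjoint from P, and a connected subset containing 1 must stay in P. -/
theorem identityComponent_Mo_le (G' : Subgroup G) [G'.FiniteIndex] :
    identityComponent (Mo ρ) ≤ Mo (res ρ G') := by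
  let P := Mo (res ρ G')
  let Q : Set (LinearMap.GeneralLinearGroup K V) :=
    ⋃ q ∈ {q : G ⧸ G' | ρ.asGroupHom q.out ∉ P}, {m | (ρ.asGroupHom q.out)⁻¹ * m ∈ P}
  have hcoset : ∀ a : LinearMap.GeneralLinearGroup K V, IsClosed {m | a * m ∈ P} := fun a =>
    (isClosed_Mo (res ρ G')).preimage (continuous_mul_left a)
  have hQ : IsClosed Q := (Set.toFinite _).isClosed_biUnion fun q _ => hcoset _
  have hcover : (Mo ρ : Set (LinearMap.GeneralLinearGroup K V)) ⊆ P ∪ Q := by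
    refine closure_minimal ?_ ((isClosed_Mo _).union hQ)
    rintro _ ⟨g, rfl⟩
    let q : G ⧸ G' := g
    have h1 : (q.out)⁻¹ * g ∈ G' := QuotientGroup.eq.1 (QuotientGroup.out_eq' q)
    have h2 : (ρ.asGroupHom q.out)⁻¹ * ρ.asGroupHom g ∈ P := by
      rw [← map_inv, ← map_mul]
      exact asGroupHom_mem_Mo_res ρ h1
    by_cases hq : ρ.asGroupHom q.out ∈ P
    · left
      have h3 := P.mul_mem hq h2
      rwa [mul_inv_cancel_left] at h3
    · right
      exact Set.mem_biUnion (show q ∈ {q : G ⧸ G' | ρ.asGroupHom q.out ∉ P} from hq) h2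
  have hdisj : ∀ m ∈ P, m ∉ Q := by
    intro m hm hmQ
    obtain ⟨q, hq, hqm⟩ := Set.mem_iUnion₂.1 hmQ
    refine hq ?_
    have h3 := P.mul_mem hm (P.inv_mem hqm)
    rwa [mul_inv_rev, inv_inv, mul_inv_cancel_left] at h3
  rcases isPreconnected_iff_subset_of_disjoint_closed.1
    (isZariskiConnected_identityComponent (Mo ρ)).2 _ _ (isClosed_Mo (res ρ G')) hQ
    (Set.Subset.trans (identityComponent_le _) hcover) (by
      rw [Set.eq_empty_iff_forall_notMem]
      rintro m ⟨-, hm, hm'⟩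
      exact hdisj m hm hm') with h | h
  · exact h
  · exact absurd (h (identityComponent (Mo ρ)).one_mem) (hdisj 1 P.one_mem)

variable [FiniteDimensional K V]

/-- Normality passes to closures one variable at a time, first in m for fixed h in H and then in s
for fixed m; separate continuity is enough. -/
theorem conj_mem_Mo_res (H : Subgroup G) [H.Normal] : ∀ m ∈ Mo ρ, ∀ s ∈ Mo (res ρ H),
    m * s * m⁻¹ ∈ Mo (res ρ H) := by
  intro m hm s hs
  have h1 : ∀ h ∈ H, ∀ m ∈ Mo ρ, m * ρ.asGroupHom h * m⁻¹ ∈ Mo (res ρ H) := by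
    intro h hh m hm
    refine closure_minimal (t := {m | m * ρ.asGroupHom h * m⁻¹ ∈ Mo (res ρ H)}) ?_
      ((isClosed_Mo (res ρ H)).preimage (continuous_conj_apply _)) hm
    rintro _ ⟨g, rfl⟩
    rw [Set.mem_ofPred_eq, ← map_inv, ← map_mul, ← map_mul]
    exact asGroupHom_mem_Mo_res ρ (Subgroup.Normal.conj_mem inferInstance h hh g)
  refine closure_minimal (t := {s | m * s * m⁻¹ ∈ Mo (res ρ H)}) ?_
    ((isClosed_Mo (res ρ H)).preimage (continuous_conj _)) hs
  rintro _ ⟨h, rfl⟩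
  exact h1 h h.2 m hm

/-- The irreducible G'-subspaces form the family fed to `lieAlg_le_of_isSemisimpleAlgGroup`, with M
the identity component of `Mo ρ`. Connectedness of M turns finite determinants into determinant 1.
-/
theorem isAlgIsomonodromic_of_isEssentiallyAdmissibleRel [IsAlgClosed K] [CharZero K]
    {H : Subgroup G} [H.Normal] (hconn : IsZariskiConnected (Mo (res ρ H)))
    (hss : IsSemisimpleAlgGroup (Mo (res ρ H))) (h : IsEssentiallyAdmissibleRel ρ H) :
    IsAlgIsomonodromic ρ H := by
  obtain ⟨G', hfin, hHG', ⟨hssr, hdet⟩, hirr⟩ := h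
  have hSM : Mo (res ρ H) ≤ identityComponent (Mo ρ) :=
    le_identityComponent hconn (Mo_res_le ρ H)
  have hprime := isPrime_vanishing (isZariskiConnected_identityComponent (Mo ρ))
  have hMG' := identityComponent_Mo_le ρ G'
  have hD : ∀ W : Subrepresentation (res ρ G'), ∀ g ∈ ((res ρ G').asGroupHom).range,
      ∀ w ∈ W.toSubmodule, (g : End K V) w ∈ W.toSubmodule := by
    rintro W _ ⟨g, rfl⟩ w hw
    exact W.apply_mem_toSubmodule g hw
  have hle : lieAlg (identityComponent (Mo ρ)) ≤ lieAlg (Mo (res ρ H)) := by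
    refine lieAlg_le_of_isSemisimpleAlgGroup hconn (isClosed_Mo _) hss hSM
      (fun m hm => conj_mem_Mo_res ρ H m (identityComponent_le _ hm)) _
      (sSup_isIrreducible_eq_top hssr) ?_ ?_ ?_ ?_
    · rintro _ ⟨W, hW, rfl⟩
      exact ((isIrreducible_iff W).1 hW).1
    · rintro _ ⟨W, hW, rfl⟩ g hg w hw
      exact apply_mem_of_mem_closure (hD W) (hMG' hg) hw
    · rintro _ ⟨W, hW, rfl⟩ g hg
      refine det_restrict_eq_one_of_finite hprime hMG' (hD W) (hdet W hW) ?_ hg _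
      rintro _ ⟨a, rfl⟩
      exact ⟨a, rfl⟩
    · rintro _ ⟨W, hW, rfl⟩ U hU hUst
      refine ((isIrreducible_comp_iff (H.subgroupOf G').subtype W).1 (hirr W hW)).2 U hU ?_
      intro a u hu
      exact hUst _ (asGroupHom_mem_Mo_res ρ (Subgroup.mem_subgroupOf.1 a.2)) u hu
  have hMS := le_of_lieAlg_le hprime (isClosed_Mo (res ρ H)) hle
  rw [IsAlgIsomonodromic, identityComponent_eq_self hconn]
  exact le_antisymm hSM hMS

theorem isEssentiallyAdmissibleRel_of_isAlgIsomonodromic [IsAlgClosed K] [CharZero K]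
    {H : Subgroup G} (hconn : IsZariskiConnected (Mo (res ρ H)))
    (hss : IsSemisimpleAlgGroup (Mo (res ρ H))) (h : IsAlgIsomonodromic ρ H) :
    IsEssentiallyAdmissibleRel ρ H := by
  rw [IsAlgIsomonodromic, identityComponent_eq_self hconn] at h
  set S := Mo (res ρ H) with hS
  have hprime := isPrime_vanishing hconn
  have hrad := hasTrivialRadical_lieAlg hconn (isClosed_Mo _) hss
  -- By hypothesis S is the identity component of `Mo ρ`, so its preimage has finite index.
  let G' : Subgroup G := S.comap ρ.asGroupHom
  have hHG' : H ≤ G' := fun a ha => asGroupHom_mem_Mo_res ρ ha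
  have hstab : ∀ U : Submodule K V, (∀ a ∈ H, ∀ u ∈ U, ρ a u ∈ U) →
      ∀ s ∈ S, ∀ u ∈ U, (s : End K V) u ∈ U := by
    intro U hU s hs u hu
    refine apply_mem_of_mem_closure (D := ((res ρ H).asGroupHom).range) ?_ hs hu
    rintro _ ⟨a, rfl⟩
    exact hU a a.2
  have hstab' : ∀ W : Subrepresentation (res ρ G'), ∀ s ∈ S, ∀ u ∈ W.toSubmodule,
      (s : End K V) u ∈ W.toSubmodule := fun W => hstab _ fun a ha u hu =>
    W.apply_mem_toSubmodule ⟨a, hHG' ha⟩ hu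
  have hfin : G'.FiniteIndex := by
    have h1 := finiteIndex_identityComponent (Mo ρ)
    rw [← h] at h1
    let f : G →* Mo ρ := ρ.asGroupHom.codRestrict (Mo ρ) (asGroupHom_mem_Mo ρ)
    have h2 : G' = (S.subgroupOf (Mo ρ)).comap f := rfl
    refine ⟨?_⟩
    rw [h2, Subgroup.index_comap]
    exact (Subgroup.isFiniteRelIndex_of_finiteIndex (K := f.range)).relIndex_ne_zero
  refine ⟨G', hfin, hHG', ⟨⟨fun W => ?_⟩, fun W hW => ?_⟩, fun W hW => ?_⟩
  -- Weyl's theorem gives a complement stable under Lie S, hence under S and under G'.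
  · let W' : LieSubmodule K (lieAlg S) V :=
      { W.toSubmodule with
        lie_mem := fun {x m} hm => lieAlg_apply_mem_of_stable (hstab' W) x.2 hm }
    obtain ⟨C, hC⟩ := exists_isCompl_lieSubmodule W'
    let C' : Subrepresentation (res ρ G') := ⟨C.toSubmodule, fun g v hv =>
      apply_mem_of_lieAlg_stable hprime (W := C.toSubmodule)
        (fun x hx w hw => C.lie_mem (x := ⟨x, hx⟩) hw) g.2 hv⟩
    refine ⟨C', ?_⟩
    have h1 : W.toSubmodule ⊓ C.toSubmodule = ⊥ := hC.inf_eq_bot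
    have h2 : W.toSubmodule ⊔ C.toSubmodule = ⊤ := hC.sup_eq_top
    exact isCompl_iff.2 ⟨disjoint_iff.2 (Subrepresentation.toSubmodule_injective h1),
      codisjoint_iff.2 (Subrepresentation.toSubmodule_injective h2)⟩
  · refine (Set.finite_singleton (1 : K)).subset ?_
    rintro _ ⟨g, rfl⟩
    have hL : ∀ x ∈ lieAlg S, ∀ w ∈ W.toSubmodule, x w ∈ W.toSubmodule := fun x hx w hw =>
      lieAlg_apply_mem_of_stable (hstab' W) hx hw
    exact det_restrict_eq_one_of_trace_eq_zero hprime hL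
      (fun x hx => trace_restrict_eq_zero_of_hasTrivialRadical _ hL hx _) g.2 (hstab' W _ g.2)
  · rw [isIrreducible_iff] at hW
    refine (isIrreducible_comp_iff (H.subgroupOf G').subtype W).2 ⟨hW.1, fun U hU hUst => ?_⟩
    refine hW.2 U hU fun g u hu => ?_
    -- H-stable subspaces are stable under the closure S of ρ(H), and G' acts through S.
    exact hstab U (fun a ha u hu => hUst ⟨⟨a, hHG' ha⟩, Subgroup.mem_subgroupOf.2 ha⟩ u hu) _ g.2 u hu

end Monodromy

end AlgMonodromy

theorem proposition4p10
    {K : Type*} [Field K] [IsAlgClosed K] [CharZero K]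
    {G : Type*} [Group G] [Group.FG G] (H : Subgroup G) [H.Normal] [Group.FG H]
    {V : Type*} [AddCommGroup V] [Module K V] [FiniteDimensional K V]
    (ρ : Representation K G V)
    (hconn : AlgMonodromy.IsZariskiConnected (AlgMonodromy.Mo (AlgMonodromy.res ρ H)))
    (hss : AlgMonodromy.IsSemisimpleAlgGroup (AlgMonodromy.Mo (AlgMonodromy.res ρ H))) :
    AlgMonodromy.IsEssentiallyAdmissibleRel ρ H ↔ AlgMonodromy.IsAlgIsomonodromic ρ H :=
  ⟨AlgMonodromy.isAlgIsomonodromic_of_isEssentiallyAdmissibleRel ρ hconn hss,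
    AlgMonodromy.isEssentiallyAdmissibleRel_of_isAlgIsomonodromic ρ hconn hss⟩
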